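/- Let $n\ge 2$, let $\Omega\subset\mathbb R^n$ be a bounded open set with $C^2$ boundary, let $T>0$ and $Q:=(0,T)\times\Omega$. Let $q=(q_{ij})_{1\le i,j\le n}$ be a (complex) matrix-valued potential on $Q$ with $q_{ij}\in W^{1,\infty}(Q)$ for all $i,j$, and for a vector-valued function $\vec v=(v_1,\dots,v_n)^T$ on $Q$ let $\mathcal L_q\vec v$ be the vector with components $(\partial_t^2-\Delta_x)v_i+\sum_{j=1}^n q_{ij}v_j$, $1\le i\le n$. Fix $\omega\in\mathbb R^n$ with $|\omega|=1$ and put $\varphi(t,x):=t+x\cdot\omega$. Then there exists $h_0>0$ such that for every constant vector $\vec K_2\in\mathbb C^n$ there is a constant $C>0$ (independent of $h$) such that for all $0<h\le h_0$ there exists $\vec v_g\in H^2(Q;\mathbb C^n)$ with $\mathcal L_q\vec v_g=0$ in $Q$ of the form $$\vec v_g(t,x)=e^{\varphi(t,x)/h}\bigl(\vec K_2+h\,\vec R_g(t,x;h)\bigr),$$ where $\vec R_g(\cdot;h)\in H^2(Q;\mathbb C^n)$ satisfies $\|\vec R_g(\cdot;h)\|_{L^2(Q)}\le C$, with $\|\vec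 R\|_{L^2(Q)}:=\bigl(\sum_{j=1}^n\int_Q|R_j|^2\,dx\,dt\bigr)^{1/2}$. -/

import Mathlib

open MeasureTheory Set

open scoped ENNReal

noncomputable section

/-- Space-time `ℝ × ℝⁿ`, points `(t, x)`, with Lebesgue measure (the product measure). -/
abbrev SpaceTime (n : ℕ) : Type := ℝ × EuclideanSpace ℝ (Fin n)

/-- The cylinder `Q = (0,T) × Ω`. -/
def spaceTimeCylinder {n : ℕ} (T : ℝ) (Ω : Set (EuclideanSpace ℝ (Fin n))) : Set (SpaceTime n) :=
  Ioo 0 T ×ˢ Ω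

/-- `∂Ω` is of class `C²`: near each boundary point `x` there are a unit vector `ν` and a `C²`
function `γ` of the component of `y` orthogonal to `ν`, such that `Ω` is the set of points `y`
lying strictly above the graph of `γ` in the direction `ν`. -/
def HasC2Boundary {n : ℕ} (Ω : Set (EuclideanSpace ℝ (Fin n))) : Prop :=
  ∀ x ∈ frontier Ω, ∃ (r : ℝ) (ν : EuclideanSpace ℝ (Fin n)) (γ : EuclideanSpace ℝ (Fin n) → ℝ),
    0 < r ∧ ‖ν‖ = 1 ∧ ContDiff ℝ 2 γ ∧
      ∀ y ∈ Metric.ball x r, (y ∈ Ω ↔ γ (y - inner ℝ ν y • ν) < inner ℝ ν y)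

/-- `w` is the weak derivative of `u` in the direction `e` on the open set `U`:
both are locally integrable on `U` and `∫_U u ∂_e φ = -∫_U w φ` for all `φ ∈ C_c^∞(U)`. -/
def HasWeakDerivOn {n : ℕ} (U : Set (SpaceTime n)) (e : SpaceTime n)
    (u w : SpaceTime n → ℂ) : Prop :=
  LocallyIntegrableOn u U ∧ LocallyIntegrableOn w U ∧
    ∀ φ : SpaceTime n → ℝ, ContDiff ℝ (⊤ : ℕ∞) φ → HasCompactSupport φ → tsupport φ ⊆ U →
      ∫ z in U, ((fderiv ℝ φ z e : ℝ) : ℂ) * u z = -∫ z in U, ((φ z : ℝ) : ℂ) * w z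

/-- The Sobolev space `W^{k,p}(U)` on an open set `U`: `u ∈ L^p(U)` and all weak derivatives of
order at most `k` are in `L^p(U)`. `W^{k,2} = H^k`. -/
def MemSobolev {n : ℕ} : ℕ → ℝ≥0∞ → Set (SpaceTime n) → (SpaceTime n → ℂ) → Prop
  | 0, p, U, u => MemLp u p (volume.restrict U)
  | k + 1, p, U, u => MemLp u p (volume.restrict U) ∧
      ∀ e : SpaceTime n, ∃ w, HasWeakDerivOn U e u w ∧ MemSobolev k p U w

/-- `H²(U)` for vector valued functions, componentwise. -/
def MemVecH2 {n : ℕ} (U : Set (SpaceTime n)) (v : SpaceTime n → Fin n → ℂ) : Prop :=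
  ∀ i, MemSobolev 2 2 U (fun z => v z i)

/-- `W^{1,∞}(U)` for matrix valued functions, entrywise. -/
def MemMatrixW1Infty {n : ℕ} (U : Set (SpaceTime n))
    (q : SpaceTime n → Matrix (Fin n) (Fin n) ℂ) : Prop :=
  ∀ i j, MemSobolev 1 ∞ U (fun z => q z i j)

/-- `w = ∂_e² u` weakly on `U`. -/
def HasWeakSecondDerivOn {n : ℕ} (U : Set (SpaceTime n)) (e : SpaceTime n)
    (u w : SpaceTime n → ℂ) : Prop :=
  ∃ u' : SpaceTime n → ℂ, HasWeakDerivOn U e u u' ∧ HasWeakDerivOn U e u' w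

/-- The time direction in space-time. -/
def timeDir (n : ℕ) : SpaceTime n := (1, 0)

/-- The `k`-th spatial coordinate direction in space-time. -/
def spaceDir {n : ℕ} (k : Fin n) : SpaceTime n := (0, EuclideanSpace.single k 1)

/-- `□u = f` on `U` almost everywhere, where `□ = ∂_t² - ∑ₖ ∂_{x_k}²` and the second derivatives
are weak derivatives (functions). -/
def HasWaveOn {n : ℕ} (U : Set (SpaceTime n)) (u f : SpaceTime n → ℂ) : Prop :=
  ∃ (utt : SpaceTime n → ℂ) (uxx : Fin n → SpaceTime n → ℂ),
    HasWeakSecondDerivOn U (timeDir n) u utt ∧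
    (∀ k, HasWeakSecondDerivOn U (spaceDir k) u (uxx k)) ∧
    ∀ᵐ z ∂(volume.restrict U), f z = utt z - ∑ k, uxx k z

/-- `L_q v = 0` on `U`: for every `i`, `□ v_i + ∑ⱼ q_{ij} v_j = 0` almost everywhere on `U`. -/
def SolvesWaveSystemOn {n : ℕ} (U : Set (SpaceTime n))
    (q : SpaceTime n → Matrix (Fin n) (Fin n) ℂ) (v : SpaceTime n → Fin n → ℂ) : Prop :=
  ∀ i, ∃ f : SpaceTime n → ℂ, HasWaveOn U (fun z => v z i) f ∧
    ∀ᵐ z ∂(volume.restrict U), f z + ∑ j, q z i j * v z j = 0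

/-- The `L²(U)` norm of a vector valued function (meaningful when its components are in `L²`). -/
def vecL2Norm {n : ℕ} (U : Set (SpaceTime n)) (v : SpaceTime n → Fin n → ℂ) : ℝ :=
  Real.sqrt (∑ j, ∫ z in U, ‖v z j‖ ^ 2)

/-- The phase `φ(t,x) = t + x · ω`. -/
def phase {n : ℕ} (ω : EuclideanSpace ℝ (Fin n)) (z : SpaceTime n) : ℝ :=
  z.1 + inner ℝ z.2 ω

end

noncomputable section

namespace WaveCGO

variable {n : ℕ}

/-! Put `a = 1/h`. Since `|ω| = 1`, the phase is characteristic: conjugating the wave operator by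
`exp (a φ)` leaves `□ + 2a(∂ₜ - ω·∇)`, with no `a²` term. The remainder `R` must then satisfy `(□ +
2a(∂ₜ - ω·∇) + q) R = -a q K`, so it suffices to invert the constant-coefficient part with norm at
most `1/a`: the large factor on the right is then absorbed and `q` becomes a small perturbation.

The symbol of that operator vanishes at the frequencies `ξ = τ ω`. Writing `R = e^t S` replaces `∂ₜ`
by `∂ₜ + 1` and removes the zeros: the new symbol `P` satisfies `|P|² ≥ a² + τ²`
(`sq_add_sq_le_norm_waveSymbol_sq`). Only a solution on `Q` is sought, with no boundary or initial
data, so the equation may be solved periodically on a box containing `Q`, by division of Fourier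
coefficients. For `a ≥ 2nM`, with `M` a bound for the extended potential, the system is a
contraction in `L²`, and `‖S‖ ≤ 2N`, where `N` bounds the extension of `e^{-t} q K`
(`exists_solution_of_hilbertBasis`).

The remaining point is `H²` regularity, as `P` is not elliptic. From `|P| ≥ |τ|` the solution has a
time derivative in `L²`. If the right hand side also has one, then `τ² Ŝ` is square summable, and
`|ξ|² ≤ |P| + τ²` controls the space derivatives (`summable_sobolevWeight`). Thus only time
regularity of the coefficients is needed. Extending them by zero in space and evenly in time keeps a
bounded time derivative that is compatible with `2T`-periodicity (`setIntegral_reflection_eq`), and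
a Leibniz rule on Fourier coefficients (`IsTimeLipschitz.repr_mul`) transfers it to the right hand
side. -/

instance isAddHaarMeasure_volume_spaceTime :
    (volume : Measure (SpaceTime n)).IsAddHaarMeasure :=
  inferInstanceAs
    ((volume : Measure ℝ).prod (volume : Measure (EuclideanSpace ℝ (Fin n)))).IsAddHaarMeasure

/-! ### Calculus of weak derivatives. -/

section WeakDerivative

variable {U : Set (SpaceTime n)} {e : SpaceTime n} {u w u' w' : SpaceTime n → ℂ}

theorem integrable_mul_of_tsupport_subset {g : SpaceTime n → ℂ}
    (hu : LocallyIntegrableOn u U) (hg : Continuous g) (hgc : HasCompactSupport g)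
    (hgU : tsupport g ⊆ U) : Integrable (fun z => g z * u z) (volume.restrict U) := by
  have h1 : IntegrableOn u (tsupport g) := hu.integrableOn_compact_subset hgU hgc
  have h2 : IntegrableOn (fun z => g z * u z) (tsupport g) :=
    h1.continuousOn_mul hg.continuousOn hgc
  have h3 : IntegrableOn (fun z => g z * u z) univ :=
    h2.of_forall_sdiff_eq_zero MeasurableSet.univ fun z hz => by
      rw [image_eq_zero_of_notMem_tsupport hz.2, zero_mul]
  exact h3.mono_set (subset_univ _)

theorem integrable_ofReal_mul_of_tsupport_subset {g : SpaceTime n → ℝ}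
    (hu : LocallyIntegrableOn u U) (hg : Continuous g) (hgc : HasCompactSupport g)
    (hgU : tsupport g ⊆ U) : Integrable (fun z => (g z : ℂ) * u z) (volume.restrict U) :=
  integrable_mul_of_tsupport_subset hu (Complex.continuous_ofReal.comp hg)
    (hgc.comp_left Complex.ofReal_zero)
    ((closure_mono (Function.support_comp_subset Complex.ofReal_zero g)).trans hgU)

theorem continuous_fderiv_dir {g : SpaceTime n → ℝ} (hg : ContDiff ℝ (⊤ : ℕ∞) g)
    (e : SpaceTime n) : Continuous fun z => fderiv ℝ g z e :=
  (hg.continuous_fderiv (by simp)).clm_apply continuous_const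

theorem integrable_fderiv_mul {g : SpaceTime n → ℝ}
    (hu : LocallyIntegrableOn u U) (hg : ContDiff ℝ (⊤ : ℕ∞) g) (hgc : HasCompactSupport g)
    (hgU : tsupport g ⊆ U) (e : SpaceTime n) :
    Integrable (fun z => ((fderiv ℝ g z e : ℝ) : ℂ) * u z) (volume.restrict U) :=
  integrable_ofReal_mul_of_tsupport_subset hu (continuous_fderiv_dir hg e)
    (hgc.fderiv_apply ℝ e) ((tsupport_fderiv_apply_subset ℝ e).trans hgU)

theorem _root_.HasWeakDerivOn.add (h : HasWeakDerivOn U e u w) (h' : HasWeakDerivOn U e u' w') :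
    HasWeakDerivOn U e (fun z => u z + u' z) (fun z => w z + w' z) := by
  refine ⟨h.1.add h'.1, h.2.1.add h'.2.1, fun φ hφ hc hs => ?_⟩
  simp only [mul_add]
  rw [integral_add (integrable_fderiv_mul h.1 hφ hc hs e) (integrable_fderiv_mul h'.1 hφ hc hs e),
    integral_add (integrable_ofReal_mul_of_tsupport_subset h.2.1 hφ.continuous hc hs)
      (integrable_ofReal_mul_of_tsupport_subset h'.2.1 hφ.continuous hc hs),
    h.2.2 φ hφ hc hs, h'.2.2 φ hφ hc hs, neg_add]

theorem _root_.HasWeakDerivOn.const_mul (h : HasWeakDerivOn U e u w) (c : ℂ) :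
    HasWeakDerivOn U e (fun z => c * u z) (fun z => c * w z) := by
  refine ⟨h.1.smul c, h.2.1.smul c, fun φ hφ hc hs => ?_⟩
  simp only [mul_left_comm _ c]
  rw [integral_const_mul, integral_const_mul, h.2.2 φ hφ hc hs, mul_neg]

theorem hasWeakDerivOn_const (U : Set (SpaceTime n)) (e : SpaceTime n) (c : ℂ) :
    HasWeakDerivOn U e (fun _ => c) fun _ => 0 := by
  refine ⟨locallyIntegrableOn_const c, locallyIntegrableOn_const 0, fun φ hφ hc hs => ?_⟩
  have hd := continuous_fderiv_dir hφ e
  -- Integration by parts against the constant function `1`.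
  have h0 : ∫ z, fderiv ℝ φ z e = 0 := by
    have := integral_mul_fderiv_eq_neg_fderiv_mul_of_integrable (𝕜 := ℝ) (μ := volume)
      (f := fun _ : SpaceTime n => (1 : ℝ)) (g := φ) (v := e) (by simp)
      (by simpa using hd.integrable_of_hasCompactSupport (hc.fderiv_apply ℝ e))
      (by simpa using hφ.continuous.integrable_of_hasCompactSupport hc)
      (fun z _ => differentiableAt_const _)
      (fun z _ => (hφ.differentiable (by simp)).differentiableAt)
    simpa using this
  rw [integral_mul_const, integral_complex_ofReal,
    setIntegral_eq_integral_of_forall_compl_eq_zero, h0]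
  · simp
  · intro z hz
    exact image_eq_zero_of_notMem_tsupport (f := fun z => fderiv ℝ φ z e)
      fun h => hz (hs (tsupport_fderiv_apply_subset ℝ e h))

/-- The product `φ exp l` is again a test function, so the Leibniz rule follows by inserting it in
the definition, without any approximation of `u`. -/
theorem _root_.HasWeakDerivOn.exp_mul (hU : IsOpen U) (h : HasWeakDerivOn U e u w)
    (l : SpaceTime n →L[ℝ] ℝ) :
    HasWeakDerivOn U e (fun z => (Real.exp (l z) : ℂ) * u z)
      (fun z => (Real.exp (l z) : ℂ) * (w z + (l e : ℂ) * u z)) := by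
  have hE : ContDiff ℝ (⊤ : ℕ∞) fun z => Real.exp (l z) := Real.contDiff_exp.comp l.contDiff
  have hEc : ContinuousOn (fun z => (Real.exp (l z) : ℂ)) U :=
    (Complex.continuous_ofReal.comp hE.continuous).continuousOn
  have hw' : LocallyIntegrableOn (fun z => w z + (l e : ℂ) * u z) U := h.2.1.add (h.1.smul (l e : ℂ))
  refine ⟨h.1.continuousOn_mul hEc hU.isLocallyClosed, hw'.continuousOn_mul hEc hU.isLocallyClosed,
    fun φ hφ hc hs => ?_⟩
  have hφE : ContDiff ℝ (⊤ : ℕ∞) fun z => φ z * Real.exp (l z) := hφ.mul hE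
  have hcE : HasCompactSupport fun z => φ z * Real.exp (l z) := hc.mul_right
  have hsE : tsupport (fun z => φ z * Real.exp (l z)) ⊆ U := (tsupport_mul_subset_left).trans hs
  have key := h.2.2 _ hφE hcE hsE
  have hder : ∀ z, fderiv ℝ (fun z => φ z * Real.exp (l z)) z e =
      fderiv ℝ φ z e * Real.exp (l z) + φ z * Real.exp (l z) * l e := by
    intro z
    have h1 : HasFDerivAt (fun z => Real.exp (l z)) (Real.exp (l z) • l) z :=
      (l.hasFDerivAt).exp
    have h2 := ((hφ.differentiable (by simp)) z).hasFDerivAt.mul h1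
    refine (DFunLike.congr_fun h2.fderiv e).trans ?_
    simp
    ring
  have i1 := integrable_fderiv_mul h.1 hφE hcE hsE e
  have i2 := integrable_ofReal_mul_of_tsupport_subset h.1 hφE.continuous hcE hsE
  have i3 := integrable_ofReal_mul_of_tsupport_subset h.2.1 hφE.continuous hcE hsE
  have e1 : ∀ z, ((fderiv ℝ φ z e : ℝ) : ℂ) * ((Real.exp (l z) : ℂ) * u z) =
      ((fderiv ℝ (fun z => φ z * Real.exp (l z)) z e : ℝ) : ℂ) * u z -
        (l e : ℂ) * (((φ z * Real.exp (l z) : ℝ) : ℂ) * u z) := by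
    intro z; rw [hder]; push_cast; ring
  have e2 : ∀ z, (φ z : ℂ) * ((Real.exp (l z) : ℂ) * (w z + (l e : ℂ) * u z)) =
      ((φ z * Real.exp (l z) : ℝ) : ℂ) * w z +
        (l e : ℂ) * (((φ z * Real.exp (l z) : ℝ) : ℂ) * u z) := by
    intro z; push_cast; ring
  simp only [e1, e2]
  rw [integral_sub i1 (i2.const_mul _), integral_add i3 (i2.const_mul _), key]
  ring

/-- The defining identity of weak derivatives holds for complex valued test functions. -/
theorem _root_.HasWeakDerivOn.integral_complex (h : HasWeakDerivOn U e u w)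
    {φ : SpaceTime n → ℂ} (hφ : ContDiff ℝ (⊤ : ℕ∞) φ) (hc : HasCompactSupport φ)
    (hs : tsupport φ ⊆ U) :
    ∫ z in U, fderiv ℝ φ z e * u z = -∫ z in U, φ z * w z := by
  have hr : ContDiff ℝ (⊤ : ℕ∞) fun z => (φ z).re := Complex.reCLM.contDiff.comp hφ
  have hi : ContDiff ℝ (⊤ : ℕ∞) fun z => (φ z).im := Complex.imCLM.contDiff.comp hφ
  have hrc : HasCompactSupport fun z => (φ z).re := hc.comp_left Complex.zero_re
  have hic : HasCompactSupport fun z => (φ z).im := hc.comp_left Complex.zero_im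
  have hrs : tsupport (fun z => (φ z).re) ⊆ U :=
    (closure_mono (Function.support_comp_subset Complex.zero_re φ)).trans hs
  have his : tsupport (fun z => (φ z).im) ⊆ U :=
    (closure_mono (Function.support_comp_subset Complex.zero_im φ)).trans hs
  have hdr : ∀ z, fderiv ℝ (fun z => (φ z).re) z e = (fderiv ℝ φ z e).re := fun z => by
    have := (Complex.reCLM.hasFDerivAt).comp z ((hφ.differentiable (by simp)) z).hasFDerivAt
    exact DFunLike.congr_fun this.fderiv e
  have hdi : ∀ z, fderiv ℝ (fun z => (φ z).im) z e = (fderiv ℝ φ z e).im := fun z => by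
    have := (Complex.imCLM.hasFDerivAt).comp z ((hφ.differentiable (by simp)) z).hasFDerivAt
    exact DFunLike.congr_fun this.fderiv e
  have e1 : ∀ z, fderiv ℝ φ z e * u z =
      ((fderiv ℝ (fun z => (φ z).re) z e : ℝ) : ℂ) * u z +
        Complex.I * (((fderiv ℝ (fun z => (φ z).im) z e : ℝ) : ℂ) * u z) := by
    intro z
    rw [hdr, hdi]
    conv_lhs => rw [← Complex.re_add_im (fderiv ℝ φ z e)]
    ring
  have e2 : ∀ z, φ z * w z = (((φ z).re : ℝ) : ℂ) * w z +
        Complex.I * ((((φ z).im : ℝ) : ℂ) * w z) := by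
    intro z
    conv_lhs => rw [← Complex.re_add_im (φ z)]
    ring
  simp only [e1, e2]
  rw [integral_add (integrable_fderiv_mul h.1 hr hrc hrs e)
      ((integrable_fderiv_mul h.1 hi hic his e).const_mul _),
    integral_add (integrable_ofReal_mul_of_tsupport_subset h.2.1 hr.continuous hrc hrs)
      ((integrable_ofReal_mul_of_tsupport_subset h.2.1 hi.continuous hic his).const_mul _),
    integral_const_mul, integral_const_mul, h.2.2 _ hr hrc hrs, h.2.2 _ hi hic his]
  ring

theorem _root_.HasWeakDerivOn.congr_ae (h : HasWeakDerivOn U e u w)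
    (hu : u =ᵐ[volume.restrict U] u') (hw : w =ᵐ[volume.restrict U] w') :
    HasWeakDerivOn U e u' w' := by
  refine ⟨h.1.congr hu, h.2.1.congr hw, fun φ hφ hc hs => ?_⟩
  rw [← integral_congr_ae (hu.mono fun z hz => congrArg (((fderiv ℝ φ z e : ℝ) : ℂ) * ·) hz),
    ← integral_congr_ae (hw.mono fun z hz => congrArg ((φ z : ℂ) * ·) hz)]
  exact h.2.2 φ hφ hc hs

end WeakDerivative

/-! ### Stability of the Sobolev spaces under linear operations and exponential weights. -/

section Sobolev

variable {U : Set (SpaceTime n)} {p : ℝ≥0∞} {u v : SpaceTime n → ℂ}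

theorem _root_.MemSobolev.memLp {k : ℕ} (h : MemSobolev k p U u) :
    MemLp u p (volume.restrict U) := by
  cases k with
  | zero => exact h
  | succ k => exact h.1

theorem _root_.MemSobolev.of_succ {k : ℕ} (h : MemSobolev (k + 1) p U u) :
    MemSobolev k p U u := by
  induction k generalizing u with
  | zero => exact h.1
  | succ k ih =>
    refine ⟨h.1, fun e => ?_⟩
    obtain ⟨w, hw, hw'⟩ := h.2 e
    exact ⟨w, hw, ih hw'⟩

theorem _root_.MemSobolev.add {k : ℕ} (hu : MemSobolev k p U u) (hv : MemSobolev k p U v) :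
    MemSobolev k p U fun z => u z + v z := by
  induction k generalizing u v with
  | zero => exact MemLp.add hu hv
  | succ k ih =>
    refine ⟨hu.1.add hv.1, fun e => ?_⟩
    obtain ⟨w, hw, hw'⟩ := hu.2 e
    obtain ⟨y, hy, hy'⟩ := hv.2 e
    exact ⟨_, hw.add hy, ih hw' hy'⟩

theorem _root_.MemSobolev.const_mul {k : ℕ} (hu : MemSobolev k p U u) (c : ℂ) :
    MemSobolev k p U fun z => c * u z := by
  induction k generalizing u with
  | zero => exact MemLp.const_mul hu c
  | succ k ih =>
    refine ⟨hu.1.const_mul c, fun e => ?_⟩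
    obtain ⟨w, hw, hw'⟩ := hu.2 e
    exact ⟨_, hw.const_mul c, ih hw'⟩

theorem memSobolev_const (k : ℕ) (p : ℝ≥0∞) (hU : volume U ≠ ∞) (c : ℂ) :
    MemSobolev k p U fun _ => c := by
  have : IsFiniteMeasure (volume.restrict U) := ⟨by simpa using hU.lt_top⟩
  induction k generalizing c with
  | zero => exact memLp_const c
  | succ k ih => exact ⟨memLp_const c, fun e => ⟨_, hasWeakDerivOn_const U e c, ih 0⟩⟩

theorem exists_exp_le_of_isBounded (hU : Bornology.IsBounded U) (l : SpaceTime n →L[ℝ] ℝ) :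
    ∃ M : ℝ, 0 < M ∧ ∀ z ∈ U, Real.exp (l z) ≤ M := by
  obtain ⟨r, hr⟩ := hU.exists_norm_le
  refine ⟨Real.exp (‖l‖ * r), Real.exp_pos _, fun z hz => Real.exp_le_exp.2 ?_⟩
  exact (le_abs_self _).trans ((l.le_opNorm z).trans (by gcongr; exact hr z hz))

theorem memLp_exp_mul (hU : Bornology.IsBounded U) (hUm : MeasurableSet U)
    (l : SpaceTime n →L[ℝ] ℝ) (hu : MemLp u p (volume.restrict U)) :
    MemLp (fun z => (Real.exp (l z) : ℂ) * u z) p (volume.restrict U) := by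
  obtain ⟨M, -, hM⟩ := exists_exp_le_of_isBounded hU l
  refine hu.of_le_mul (c := M) ?_ ?_
  · exact ((Complex.continuous_ofReal.comp
      (Real.continuous_exp.comp l.continuous)).aestronglyMeasurable).mul hu.1
  · refine (ae_restrict_iff' hUm).2 (Filter.Eventually.of_forall fun z hz => ?_)
    rw [norm_mul, Complex.norm_real, Real.norm_of_nonneg (Real.exp_pos _).le]
    exact mul_le_mul_of_nonneg_right (hM z hz) (norm_nonneg _)

/-- The derivative of `exp l * u` is `exp l` times a function with one order of regularity less, so
the induction closes on functions of this same form. -/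
theorem _root_.MemSobolev.exp_mul {k : ℕ} (hU : Bornology.IsBounded U) (hUo : IsOpen U)
    (hu : MemSobolev k p U u) (l : SpaceTime n →L[ℝ] ℝ) :
    MemSobolev k p U fun z => (Real.exp (l z) : ℂ) * u z := by
  induction k generalizing u with
  | zero => exact memLp_exp_mul hU hUo.measurableSet l hu
  | succ k ih =>
    refine ⟨memLp_exp_mul hU hUo.measurableSet l hu.1, fun e => ?_⟩
    obtain ⟨w, hw, hw'⟩ := hu.2 e
    exact ⟨_, hw.exp_mul hUo l, ih (hw'.add (hu.of_succ.const_mul _))⟩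

end Sobolev

end WaveCGO

/-! ### Fourier basis on a box containing the cylinder. -/

namespace WaveCGO

variable {n : ℕ}

/-- A box in space-time containing `(-T,T) × Ω`, with an orthonormal Hilbert basis of
exponentials `z ↦ exp (i θ_k(z))` for its normalised Lebesgue measure; the time frequencies are
integer multiples of `π / T`. -/
structure FourierBox (n : ℕ) (T : ℝ) (Ω : Set (EuclideanSpace ℝ (Fin n))) where
  box : Set (SpaceTime n)
  measurableSet_box : MeasurableSet box
  mem_box : ∀ t x, |t| < T → x ∈ Ω → (t, x) ∈ box
  scale : ℝ≥0∞
  scale_ne_zero : scale ≠ 0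
  scale_ne_top : scale ≠ ∞
  isProbabilityMeasure : IsProbabilityMeasure (scale • volume.restrict box)
  freq : (Fin (n + 1) → ℤ) → SpaceTime n →L[ℝ] ℝ
  freq_zero : freq 0 = 0
  freq_sub : ∀ k j, freq (k - j) = freq k - freq j
  freq_time : ∀ k, ∃ m : ℤ, freq k (timeDir n) * T = Real.pi * m
  basis : HilbertBasis (Fin (n + 1) → ℤ) ℂ (Lp ℂ 2 (scale • volume.restrict box))
  coe_basis : ∀ k, basis k =ᵐ[scale • volume.restrict box] fun z => Complex.exp (Complex.I * freq k z)

section Construction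

/-- Pulling back a Hilbert basis of `L²` along a measure preserving map which is a.e. invertible. -/
theorem exists_hilbertBasis_comp {α β ι : Type*} [MeasurableSpace α] [MeasurableSpace β]
    {μ : Measure α} {ν : Measure β} (b : HilbertBasis ι ℂ (Lp ℂ 2 ν)) {f : α → β} {g : β → α}
    (hf : MeasurePreserving f μ ν) (hg : Measurable g) (hgf : ∀ᵐ x ∂μ, g (f x) = x) :
    ∃ b' : HilbertBasis ι ℂ (Lp ℂ 2 μ), ∀ i, b' i =ᵐ[μ] b i ∘ f := by
  -- An a.e. left inverse of a measure preserving map preserves measure as well; composition with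
  -- `g` then gives surjectivity of composition with `f`.
  have hg' : MeasurePreserving g ν μ := by
    refine ⟨hg, ?_⟩
    rw [← hf.map_eq, Measure.map_map hg hf.measurable]
    exact (Measure.map_congr hgf).trans Measure.map_id
  let Φ : Lp ℂ 2 ν →ₗᵢ[ℂ] Lp ℂ 2 μ := Lp.compMeasurePreservingₗᵢ ℂ f hf
  have hΦ : ∀ u : Lp ℂ 2 ν, Φ u =ᵐ[μ] u ∘ f := fun u => Lp.coeFn_compMeasurePreserving u hf
  have hsurj : Function.Surjective Φ := by
    intro u
    refine ⟨Lp.compMeasurePreserving g hg' u, ?_⟩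
    apply Lp.ext
    have h1 := hf.quasiMeasurePreserving.ae_eq_comp (Lp.coeFn_compMeasurePreserving u hg')
    refine (hΦ _).trans (h1.trans ?_)
    filter_upwards [hgf] with x hx
    simp [hx]
  let Ψ := LinearIsometryEquiv.ofSurjective Φ hsurj
  refine ⟨HilbertBasis.ofRepr (Ψ.symm.trans b.repr), fun i => ?_⟩
  classical
  have : HilbertBasis.ofRepr (Ψ.symm.trans b.repr) i = Φ (b i) := by
    rw [← HilbertBasis.repr_symm_single, ← HilbertBasis.repr_symm_single]
    rfl
  rw [this]
  exact hΦ _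

/-- The linear rescaling `(t, x) ↦ (t / (2T), x / (2M))` in coordinates. -/
def rescale (n : ℕ) (T M : ℝ) (hT : 0 < T) (hM : 0 < M) :
    SpaceTime n ≃L[ℝ] (Fin (n + 1) → ℝ) :=
  LinearEquiv.toContinuousLinearEquiv
    { toFun := fun z => Fin.cons (z.1 / (2 * T)) fun j => z.2 j / (2 * M)
      invFun := fun y => (2 * T * y 0, WithLp.toLp 2 fun j => 2 * M * y j.succ)
      map_add' := fun z z' => by
        ext i
        refine Fin.cases ?_ (fun j => ?_) i <;> simp [add_div]
      map_smul' := fun r z => by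
        ext i
        refine Fin.cases ?_ (fun j => ?_) i <;> simp [mul_div_assoc]
      left_inv := fun z => by
        refine Prod.ext ?_ (PiLp.ext fun j => ?_) <;> simp <;> field_simp
      right_inv := fun y => by
        ext i
        refine Fin.cases ?_ (fun j => ?_) i <;> simp <;> field_simp }

theorem rescale_zero {T M : ℝ} (hT : 0 < T) (hM : 0 < M) (z : SpaceTime n) :
    rescale n T M hT hM z 0 = z.1 / (2 * T) := rfl

theorem rescale_succ {T M : ℝ} (hT : 0 < T) (hM : 0 < M) (z : SpaceTime n) (j : Fin n) :
    rescale n T M hT hM z j.succ = z.2 j / (2 * M) := rfl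

local instance measureSpaceUnitAddCircle : MeasureSpace UnitAddCircle :=
  ⟨AddCircle.haarAddCircle⟩

/-- The fundamental cube is centred at the origin so that its rescaling is symmetric in time, as the
reflection argument requires. -/
theorem map_coe_unitAddTorus (d : ℕ) :
    Measure.map (fun (y : Fin d → ℝ) i => (y i : UnitAddCircle))
      (volume.restrict {y : Fin d → ℝ | ∀ i, y i ∈ Ioc (-1 / 2 : ℝ) (-1 / 2 + 1)}) =
      (volume : Measure (UnitAddTorus (Fin d))) := by
  have hm : Measurable fun (y : Fin d → ℝ) i => (y i : UnitAddCircle) :=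
    measurable_pi_lambda _ fun i => AddCircle.measurable_mk'.comp (measurable_pi_apply i)
  ext s hs
  have h := UnitAddTorus.lintegral_preimage (d := Fin d) (s.indicator 1) fun _ => -1 / 2
  rw [lintegral_indicator_one hs] at h
  refine Eq.trans ?_ h.symm
  rw [← lintegral_indicator_one hs, lintegral_map (measurable_one.indicator hs) hm]

theorem mFourier_coe_eq_exp {d : ℕ} (k : Fin d → ℤ) (y : Fin d → ℝ) :
    UnitAddTorus.mFourier k (fun i => (y i : UnitAddCircle)) =
      Complex.exp (Complex.I * ((∑ i, 2 * Real.pi * k i * y i : ℝ) : ℂ)) := by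
  simp only [UnitAddTorus.mFourier, ContinuousMap.coe_mk, fourier_coe_apply]
  rw [← Complex.exp_sum]
  congr 1
  push_cast
  rw [Finset.mul_sum]
  exact Finset.sum_congr rfl fun i _ => by ring

/-- The box is `(-T,T] × (-M,M]ⁿ`, and its basis is the Fourier basis of the torus pulled back along
the rescaling. -/
theorem exists_fourierBox {T : ℝ} (hT : 0 < T) {Ω : Set (EuclideanSpace ℝ (Fin n))}
    (hΩ : Bornology.IsBounded Ω) : Nonempty (FourierBox n T Ω) := by
  obtain ⟨M, hM0, hM⟩ : ∃ M : ℝ, 0 < M ∧ ∀ x ∈ Ω, ‖x‖ < M := by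
    obtain ⟨r, hr⟩ := hΩ.exists_norm_le
    exact ⟨|r| + 1, by positivity, fun x hx => (hr x hx).trans_lt
      ((le_abs_self r).trans_lt (lt_add_one _))⟩
  set A := rescale n T M hT hM0 with hA
  set box' : Set (Fin (n + 1) → ℝ) := {y | ∀ i, y i ∈ Ioc (-1 / 2 : ℝ) (-1 / 2 + 1)} with hbox'
  have hbox'm : MeasurableSet box' := by
    have : box' = univ.pi fun _ => Ioc (-1 / 2 : ℝ) (-1 / 2 + 1) := by
      ext y; simp [hbox']
    rw [this]
    exact MeasurableSet.univ_pi fun _ => measurableSet_Ioc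
  have hAm : Measurable A := A.continuous.measurable
  -- The Jacobian of the rescaling. Uniqueness of Haar measure provides it; only its being positive
  -- and finite matters.
  set c0 := Measure.addHaarScalarFactor (Measure.map A (volume : Measure (SpaceTime n)))
    (volume : Measure (Fin (n + 1) → ℝ)) with hc0
  have hmapA : Measure.map A (volume : Measure (SpaceTime n)) = c0 • volume :=
    Measure.isAddLeftInvariant_eq_smul _ _
  have hc0pos : 0 < c0 := Measure.addHaarScalarFactor_pos_of_isAddHaarMeasure _ _
  have hc0' : (c0 : ℝ≥0∞) ≠ 0 := by exact_mod_cast hc0pos.ne'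
  set c : ℝ≥0∞ := (c0 : ℝ≥0∞)⁻¹ with hc
  set f : SpaceTime n → UnitAddTorus (Fin (n + 1)) := fun z i => (A z i : UnitAddCircle) with hf
  have hm : Measurable fun (y : Fin (n + 1) → ℝ) i => (y i : UnitAddCircle) :=
    measurable_pi_lambda _ fun i => AddCircle.measurable_mk'.comp (measurable_pi_apply i)
  have hfm : Measurable f := hm.comp hAm
  have hmp : MeasurePreserving f (c • volume.restrict (A ⁻¹' box'))
      (volume : Measure (UnitAddTorus (Fin (n + 1)))) := by
    refine ⟨hfm, ?_⟩
    rw [Measure.map_smul, hf, ← map_coe_unitAddTorus]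
    change c • Measure.map ((fun (y : Fin (n + 1) → ℝ) i => (y i : UnitAddCircle)) ∘ A) _ = _
    rw [← Measure.map_map hm hAm, ← Measure.restrict_map hAm hbox'm, hmapA,
      Measure.restrict_smul, Measure.map_smul]
    change c • ((c0 : ℝ≥0∞) • Measure.map (fun (y : Fin (n + 1) → ℝ) i => (y i : UnitAddCircle))
      (volume.restrict box')) = _
    rw [smul_smul, hc, ENNReal.inv_mul_cancel hc0' ENNReal.coe_ne_top, one_smul]
  have hprob : IsProbabilityMeasure (volume : Measure (UnitAddTorus (Fin (n + 1)))) := by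
    have : IsProbabilityMeasure (volume : Measure UnitAddCircle) :=
      inferInstanceAs (IsProbabilityMeasure AddCircle.haarAddCircle)
    exact inferInstanceAs (IsProbabilityMeasure (Measure.pi fun _ => volume))
  set g : UnitAddTorus (Fin (n + 1)) → SpaceTime n := fun x =>
    A.symm (UnitAddTorus.measurableEquivPiIoc (fun _ => -1 / 2) x).1 with hg
  have hgm : Measurable g := A.symm.continuous.measurable.comp
    (measurable_subtype_coe.comp (MeasurableEquiv.measurable _))
  have hgf : ∀ᵐ z ∂(c • volume.restrict (A ⁻¹' box')), g (f z) = z := by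
    refine Measure.ae_smul_measure ?_ c
    refine (ae_restrict_iff' (hAm hbox'm)).2 (Filter.Eventually.of_forall fun z hz => ?_)
    have := (UnitAddTorus.measurableEquivPiIoc fun _ : Fin (n + 1) => (-1 / 2 : ℝ)).apply_symm_apply
      ⟨A z, hz⟩
    rw [UnitAddTorus.coe_symm_measurableEquivPiIoc_apply] at this
    simp only [hg, hf]
    rw [this, A.symm_apply_apply]
  obtain ⟨b, hb⟩ := exists_hilbertBasis_comp UnitAddTorus.mFourierBasis hmp hgm hgf
  refine ⟨{ box := A ⁻¹' box'
            measurableSet_box := hAm hbox'm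
            mem_box := ?_
            scale := c
            scale_ne_zero := ENNReal.inv_ne_zero.2 ENNReal.coe_ne_top
            scale_ne_top := ENNReal.inv_ne_top.2 hc0'
            isProbabilityMeasure := ⟨by
              rw [← preimage_univ (f := f), hmp.measure_preimage MeasurableSet.univ.nullMeasurableSet,
                measure_univ]⟩
            freq := fun k => ∑ i, (2 * Real.pi * k i : ℝ) •
              ((ContinuousLinearMap.proj i : (Fin (n + 1) → ℝ) →L[ℝ] ℝ).comp
                (A : SpaceTime n →L[ℝ] Fin (n + 1) → ℝ))
            freq_zero := by simp
            freq_sub := fun k j => by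
              refine ContinuousLinearMap.ext fun z => ?_
              simp [mul_sub, sub_mul, Finset.sum_sub_distrib]
            freq_time := fun k => ⟨k 0, ?_⟩
            basis := b
            coe_basis := fun k => ?_ }⟩
  · intro t x ht hx i
    rw [abs_lt] at ht
    refine Fin.cases ?_ (fun j => ?_) i
    · rw [hA, rescale_zero]
      constructor
      · rw [lt_div_iff₀ (by positivity)]; simp; linarith
      · rw [div_le_iff₀ (by positivity)]; simp; linarith
    · rw [hA, rescale_succ]
      have h1 : |x j| < M := (PiLp.norm_apply_le x j).trans_lt (hM x hx)
      rw [abs_lt] at h1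
      constructor
      · rw [lt_div_iff₀ (by positivity)]; simp; linarith
      · rw [div_le_iff₀ (by positivity)]; simp; linarith
  · simp [Fin.sum_univ_succ, hA, rescale_zero, rescale_succ, timeDir]
    field_simp
  · refine (hb k).trans ?_
    have h1 : (UnitAddTorus.mFourierBasis k : Lp ℂ 2 (volume : Measure (UnitAddTorus _))) =ᵐ[volume]
        UnitAddTorus.mFourier k := by
      rw [UnitAddTorus.coe_mFourierBasis]
      exact UnitAddTorus.coeFn_mFourierLp 2 k
    refine (hmp.quasiMeasurePreserving.ae_eq_comp h1).trans
      (Filter.Eventually.of_forall fun z => ?_)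
    simp only [Function.comp_apply, hf]
    rw [mFourier_coe_eq_exp]
    simp
end Construction

end WaveCGO

/-! ### Time cutoffs and a larger class of test functions. -/

namespace WaveCGO

open Filter Topology

variable {n : ℕ}

section Cutoff

theorem deriv_smoothTransition_eq_zero {y : ℝ} (hy : y < 0 ∨ 1 < y) :
    deriv Real.smoothTransition y = 0 := by
  rcases hy with hy | hy
  · have : Real.smoothTransition =ᶠ[𝓝 y] fun _ => 0 := by
      filter_upwards [Iio_mem_nhds hy] with x hx
      exact Real.smoothTransition.zero_of_nonpos (le_of_lt hx)
    rw [this.deriv_eq]; simp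
  · have : Real.smoothTransition =ᶠ[𝓝 y] fun _ => 1 := by
      filter_upwards [Ioi_mem_nhds hy] with x hx
      exact Real.smoothTransition.one_of_one_le (le_of_lt hx)
    rw [this.deriv_eq]; simp

theorem exists_deriv_smoothTransition_le :
    ∃ L : ℝ, 0 ≤ L ∧ ∀ y, |deriv Real.smoothTransition y| ≤ L := by
  have hc : Continuous (deriv Real.smoothTransition) :=
    (Real.smoothTransition.contDiff (n := 1)).continuous_deriv le_rfl
  obtain ⟨L, hL⟩ := (isCompact_Icc (a := (0 : ℝ)) (b := 1)).exists_bound_of_continuousOn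
    hc.continuousOn
  refine ⟨max L 0, le_max_right _ _, fun y => ?_⟩
  by_cases hy : y ∈ Icc (0 : ℝ) 1
  · exact (hL y hy).trans (le_max_left _ _)
  · rw [mem_Icc, not_and_or, not_le, not_le] at hy
    rw [deriv_smoothTransition_eq_zero hy]; simp

/-- A smooth function of time vanishing near `0` and `T`, and equal to `1` away from them. -/
def timeCutoff (T m t : ℝ) : ℝ :=
  Real.smoothTransition (m * t - 1) * Real.smoothTransition (m * (T - t) - 1)

theorem contDiff_timeCutoff (T m : ℝ) : ContDiff ℝ (⊤ : ℕ∞) (timeCutoff T m) := by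
  unfold timeCutoff
  exact (Real.smoothTransition.contDiff.comp (by fun_prop)).mul
    (Real.smoothTransition.contDiff.comp (by fun_prop))

theorem abs_timeCutoff_le (T m t : ℝ) : |timeCutoff T m t| ≤ 1 := by
  unfold timeCutoff
  rw [abs_of_nonneg (mul_nonneg (Real.smoothTransition.nonneg _) (Real.smoothTransition.nonneg _))]
  exact mul_le_one₀ (Real.smoothTransition.le_one _) (Real.smoothTransition.nonneg _)
    (Real.smoothTransition.le_one _)

theorem deriv_timeCutoff (T m t : ℝ) :
    deriv (timeCutoff T m) t =
      m * deriv Real.smoothTransition (m * t - 1) * Real.smoothTransition (m * (T - t) - 1) -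
      m * deriv Real.smoothTransition (m * (T - t) - 1) * Real.smoothTransition (m * t - 1) := by
  have hd : ∀ y, HasDerivAt Real.smoothTransition (deriv Real.smoothTransition y) y := fun y =>
    ((Real.smoothTransition.contDiff (n := 1)).differentiable one_ne_zero y).hasDerivAt
  have h1 : HasDerivAt (fun t => m * t - 1) m t := by
    simpa using ((hasDerivAt_id t).const_mul m).sub_const 1
  have h2 : HasDerivAt (fun t => m * (T - t) - 1) (-m) t := by
    simpa using (((hasDerivAt_id t).const_sub T).const_mul m).sub_const 1
  have h3 := ((hd _).comp t h1).mul ((hd _).comp t h2)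
  refine h3.deriv.trans ?_
  simp only [Function.comp_apply]
  ring

/-- The derivative of the cutoff has size `m`, but only within distance `2/m` of the endpoints,
where `y` is at most `2D/m`. Hence the bound is uniform in `m`, which allows dominated convergence
as `m → ∞`. -/
theorem norm_deriv_timeCutoff_mul_le {T m t D L : ℝ} {y : ℂ} (hm : 0 < m)
    (hL0 : 0 ≤ L) (hL : ∀ y, |deriv Real.smoothTransition y| ≤ L)
    (hD : 0 ≤ D) (h1 : ‖y‖ ≤ D * t) (h2 : ‖y‖ ≤ D * (T - t)) :
    ‖((deriv (timeCutoff T m) t : ℝ) : ℂ) * y‖ ≤ 4 * L * D := by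
  have key : ∀ r : ℝ, ∀ b : ℝ, 0 ≤ b → b ≤ 1 → ‖y‖ ≤ D * r →
      |m * deriv Real.smoothTransition (m * r - 1) * b| * ‖y‖ ≤ 2 * L * D := by
    intro r b hb0 hb1 hr
    by_cases hr1 : 1 < m * r - 1
    · rw [deriv_smoothTransition_eq_zero (Or.inr hr1)]
      simp; positivity
    · rw [abs_mul, abs_mul, abs_of_pos hm, abs_of_nonneg hb0]
      have hmr : m * r ≤ 2 := by linarith
      calc m * |deriv Real.smoothTransition (m * r - 1)| * b * ‖y‖
          ≤ m * L * 1 * (D * r) := by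
            have := hL (m * r - 1)
            gcongr
        _ = L * D * (m * r) := by ring
        _ ≤ L * D * 2 := by gcongr
        _ = 2 * L * D := by ring
  rw [norm_mul, Complex.norm_real, deriv_timeCutoff, Real.norm_eq_abs]
  refine (mul_le_mul_of_nonneg_right (abs_sub _ _) (norm_nonneg _)).trans ?_
  rw [add_mul]
  have k1 := key t _ (Real.smoothTransition.nonneg (m * (T - t) - 1))
    (Real.smoothTransition.le_one _) h1
  have k2 := key (T - t) _ (Real.smoothTransition.nonneg (m * t - 1))
    (Real.smoothTransition.le_one _) h2
  linarith

theorem hasDerivAt_fst_fderiv_timeDir {ψ : SpaceTime n → ℂ} (hψ : Differentiable ℝ ψ) (t : ℝ)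
    (x : EuclideanSpace ℝ (Fin n)) :
    HasDerivAt (fun s => ψ (s, x)) (fderiv ℝ ψ (t, x) (timeDir n)) t := by
  have h1 : HasDerivAt (fun s : ℝ => ((s, x) : SpaceTime n)) (timeDir n) t :=
    (hasDerivAt_id t).prodMk (hasDerivAt_const t x)
  exact (hψ (t, x)).hasFDerivAt.comp_hasDerivAt t h1

/-- The weak time derivative on a cylinder may be tested against smooth functions which vanish
only at the initial and final times. -/
theorem integral_fderiv_timeDir_mul_eq {T : ℝ} {Ω : Set (EuclideanSpace ℝ (Fin n))}
    (hΩ : IsOpen Ω) (hΩb : Bornology.IsBounded Ω) {f w : SpaceTime n → ℂ}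
    (h : HasWeakDerivOn (spaceTimeCylinder T Ω) (timeDir n) f w)
    (hf : Integrable f (volume.restrict (spaceTimeCylinder T Ω)))
    (hw : Integrable w (volume.restrict (spaceTimeCylinder T Ω)))
    {ψ : SpaceTime n → ℂ} (hψ : ContDiff ℝ (⊤ : ℕ∞) ψ) (h0 : ∀ x, ψ (0, x) = 0)
    (hT : ∀ x, ψ (T, x) = 0) {D : ℝ} (hD : ∀ z, ‖fderiv ℝ ψ z (timeDir n)‖ ≤ D) :
    ∫ z in spaceTimeCylinder T Ω, fderiv ℝ ψ z (timeDir n) * f z =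
      -∫ z in spaceTimeCylinder T Ω, ψ z * w z := by
  set Q := spaceTimeCylinder T Ω with hQ
  have hQo : IsOpen Q := isOpen_Ioo.prod hΩ
  have hQb : Bornology.IsBounded Q := (Metric.isBounded_Ioo 0 T).prod hΩb
  have hψd : Differentiable ℝ ψ := hψ.differentiable (by simp)
  have hD0 : 0 ≤ D := (norm_nonneg _).trans (hD 0)
  -- With the vanishing of `ψ` at times `0` and `T`, this gives linear decay towards both ends of
  -- the cylinder.
  have hbound : ∀ s t x, ‖ψ (t, x) - ψ (s, x)‖ ≤ D * |t - s| := by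
    intro s t x
    exact convex_univ.norm_image_sub_le_of_norm_hasDerivWithin_le (f := fun s => ψ (s, x))
      (fun r _ => (hasDerivAt_fst_fderiv_timeDir hψd r x).hasDerivWithinAt) (fun r _ => hD _)
      (mem_univ s) (mem_univ t)
  have hb1 : ∀ z ∈ Q, ‖ψ z‖ ≤ D * z.1 := by
    rintro ⟨t, x⟩ hz
    have := hbound 0 t x
    rw [h0, sub_zero, sub_zero, abs_of_pos hz.1.1] at this
    exact this
  have hb2 : ∀ z ∈ Q, ‖ψ z‖ ≤ D * (T - z.1) := by
    rintro ⟨t, x⟩ hz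
    have := hbound T t x
    rw [hT, sub_zero, abs_sub_comm, abs_of_pos (sub_pos.2 hz.1.2)] at this
    exact this
  obtain ⟨L, hL0, hL⟩ := exists_deriv_smoothTransition_le
  -- A smooth nonnegative `g` that is nonzero exactly on `Ω` yields the space cutoffs. They do not
  -- depend on time, so their gradients, however large, never enter.
  obtain ⟨g, hgs, hgd, hgr⟩ := hΩ.exists_contDiff_support_eq (n := (⊤ : ℕ∞))
  set χ : ℕ → ℝ → ℝ := fun m => timeCutoff T (m + 1) with hχ
  set η : ℕ → EuclideanSpace ℝ (Fin n) → ℝ := fun m x =>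
    Real.smoothTransition ((m + 1) * g x - 1) with hη
  have hηd : ∀ m, ContDiff ℝ (⊤ : ℕ∞) (η m) := fun m =>
    Real.smoothTransition.contDiff.comp ((contDiff_const.mul hgd).sub contDiff_const)
  have hη1 : ∀ m x, ‖(η m x : ℂ)‖ ≤ 1 := fun m x => by
    rw [Complex.norm_real, Real.norm_of_nonneg (Real.smoothTransition.nonneg _)]
    exact Real.smoothTransition.le_one _
  have hχ1 : ∀ m t, ‖(χ m t : ℂ)‖ ≤ 1 := fun m t => by
    rw [Complex.norm_real]; exact abs_timeCutoff_le _ _ _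
  set φ : ℕ → SpaceTime n → ℂ := fun m z => (χ m z.1 : ℂ) * (η m z.2 : ℂ) * ψ z with hφ
  have hφd : ∀ m, ContDiff ℝ (⊤ : ℕ∞) (φ m) := fun m =>
    ((Complex.ofRealCLM.contDiff.comp ((contDiff_timeCutoff T _).comp contDiff_fst)).mul
      (Complex.ofRealCLM.contDiff.comp ((hηd m).comp contDiff_snd))).mul hψ
  have hφt : ∀ m, HasCompactSupport (φ m) ∧ tsupport (φ m) ⊆ Q := by
    intro m
    have hm : (0 : ℝ) < m + 1 := by positivity
    set K : Set (SpaceTime n) := {z | 1 ≤ ((m : ℝ) + 1) * z.1} ∩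
      ({z | 1 ≤ ((m : ℝ) + 1) * (T - z.1)} ∩ {z | 1 ≤ ((m : ℝ) + 1) * g z.2}) with hK
    have hKc : IsClosed K := by
      have hgc := hgd.continuous
      exact (isClosed_le continuous_const (by fun_prop)).inter
        ((isClosed_le continuous_const (by fun_prop)).inter
          (isClosed_le continuous_const (by fun_prop)))
    have hKQ : K ⊆ Q := by
      rintro ⟨t, x⟩ ⟨h1, h2, h3⟩
      simp only [mem_ofPred_eq] at h1 h2 h3
      refine ⟨⟨pos_of_mul_pos_right (zero_lt_one.trans_le h1) hm.le,
        sub_pos.1 (pos_of_mul_pos_right (zero_lt_one.trans_le h2) hm.le)⟩, ?_⟩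
      have : g x ≠ 0 := (pos_of_mul_pos_right (zero_lt_one.trans_le h3) hm.le).ne'
      change x ∈ Ω
      rw [← hgs]
      exact this
    have hsub : tsupport (φ m) ⊆ K := by
      refine closure_minimal (fun z hz => ?_) hKc
      rw [Function.mem_support] at hz
      refine ⟨?_, ?_, ?_⟩ <;> by_contra hcon <;> simp only [mem_ofPred_eq, not_le] at hcon <;>
        apply hz <;> simp only [hφ, hχ, hη, timeCutoff]
      · rw [Real.smoothTransition.zero_of_nonpos (x := (m + 1) * z.1 - 1) (by linarith)]; simp
      · rw [Real.smoothTransition.zero_of_nonpos (x := (m + 1) * (T - z.1) - 1) (by linarith)]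
        simp
      · rw [Real.smoothTransition.zero_of_nonpos (x := (m + 1) * g z.2 - 1) (by linarith)]; simp
    have hKcomp : IsCompact K := Metric.isCompact_of_isClosed_isBounded hKc (hQb.subset hKQ)
    exact ⟨HasCompactSupport.of_support_subset_isCompact hKcomp (subset_closure.trans hsub),
      hsub.trans hKQ⟩
  have hφ' : ∀ m z, fderiv ℝ (φ m) z (timeDir n) = (η m z.2 : ℂ) *
      (((deriv (χ m) z.1 : ℝ) : ℂ) * ψ z + (χ m z.1 : ℂ) * fderiv ℝ ψ z (timeDir n)) := by
    rintro m ⟨t, x⟩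
    have h1 := hasDerivAt_fst_fderiv_timeDir ((hφd m).differentiable (by simp)) t x
    have h2 : HasDerivAt (χ m) (deriv (χ m) t) t :=
      ((contDiff_timeCutoff T _).differentiable (by simp) t).hasDerivAt
    have h3 := (h2.ofReal_comp.mul_const (η m x : ℂ)).mul (hasDerivAt_fst_fderiv_timeDir hψd t x)
    refine (h1.unique h3).trans ?_
    simp only
    ring
  have key : ∀ m, ∫ z in Q, fderiv ℝ (φ m) z (timeDir n) * f z = -∫ z in Q, φ m z * w z :=
    fun m => h.integral_complex (hφd m) (hφt m).1 (hφt m).2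
  have hev : ∀ z ∈ Q, ∀ᶠ m : ℕ in atTop, χ m z.1 = 1 ∧ η m z.2 = 1 ∧ deriv (χ m) z.1 = 0 := by
    rintro ⟨t, x⟩ ⟨⟨ht0, htT⟩, hx⟩
    have hgx : 0 < g x := by
      have h1 : g x ≠ 0 := by
        change x ∈ Function.support g
        rw [hgs]; exact hx
      exact lt_of_le_of_ne (hgr ⟨x, rfl⟩).1 h1.symm
    have hlim : ∀ r : ℝ, 0 < r → ∀ᶠ m : ℕ in atTop, 1 < ((m : ℝ) + 1) * r - 1 := by
      intro r hr
      have : Tendsto (fun m : ℕ => ((m : ℝ) + 1) * r) atTop atTop :=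
        (tendsto_atTop_add_const_right _ _ tendsto_natCast_atTop_atTop).atTop_mul_const hr
      filter_upwards [this.eventually_gt_atTop 2] with m hm
      linarith
    filter_upwards [hlim t ht0, hlim (T - t) (sub_pos.2 htT), hlim (g x) hgx] with m h1 h2 h3
    refine ⟨?_, Real.smoothTransition.one_of_one_le h3.le, ?_⟩
    · simp only [hχ, timeCutoff]
      rw [Real.smoothTransition.one_of_one_le h1.le, Real.smoothTransition.one_of_one_le h2.le,
        one_mul]
    · simp only [hχ, deriv_timeCutoff]
      rw [deriv_smoothTransition_eq_zero (Or.inr h1), deriv_smoothTransition_eq_zero (Or.inr h2)]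
      simp
  have lim1 : Tendsto (fun m => ∫ z in Q, fderiv ℝ (φ m) z (timeDir n) * f z) atTop
      (𝓝 (∫ z in Q, fderiv ℝ ψ z (timeDir n) * f z)) := by
    refine tendsto_integral_of_dominated_convergence (fun z => (4 * L * D + D) * ‖f z‖)
      (fun m => ?_) (hf.norm.const_mul _) (fun m => ?_) ?_
    · exact (((hφd m).continuous_fderiv (by simp)).clm_apply
        continuous_const).aestronglyMeasurable.mul hf.1
    · refine (ae_restrict_iff' hQo.measurableSet).2 (Eventually.of_forall fun z hz => ?_)
      rw [norm_mul, hφ', norm_mul]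
      refine mul_le_mul_of_nonneg_right ?_ (norm_nonneg _)
      have b1 : ‖((deriv (χ m) z.1 : ℝ) : ℂ) * ψ z‖ ≤ 4 * L * D :=
        norm_deriv_timeCutoff_mul_le (by positivity) hL0 hL hD0 (hb1 z hz) (hb2 z hz)
      have b2 : ‖(χ m z.1 : ℂ) * fderiv ℝ ψ z (timeDir n)‖ ≤ D := by
        rw [norm_mul]
        exact (mul_le_of_le_one_left (norm_nonneg _) (hχ1 m _)).trans (hD z)
      exact (mul_le_of_le_one_left (norm_nonneg _) (hη1 m _)).trans
        ((norm_add_le _ _).trans (add_le_add b1 b2))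
    · refine (ae_restrict_iff' hQo.measurableSet).2 (Eventually.of_forall fun z hz => ?_)
      refine tendsto_nhds_of_eventually_eq ?_
      filter_upwards [hev z hz] with m hm
      rw [hφ', hm.1, hm.2.1, hm.2.2]
      simp
  have lim2 : Tendsto (fun m => ∫ z in Q, φ m z * w z) atTop (𝓝 (∫ z in Q, ψ z * w z)) := by
    refine tendsto_integral_of_dominated_convergence (fun z => (D * T) * ‖w z‖)
      (fun m => (hφd m).continuous.aestronglyMeasurable.mul hw.1) (hw.norm.const_mul _)
      (fun m => ?_) ?_
    · refine (ae_restrict_iff' hQo.measurableSet).2 (Eventually.of_forall fun z hz => ?_)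
      rw [norm_mul]
      refine mul_le_mul_of_nonneg_right ?_ (norm_nonneg _)
      simp only [hφ, norm_mul]
      refine (mul_le_of_le_one_left (norm_nonneg _)
        (mul_le_one₀ (hχ1 m _) (norm_nonneg _) (hη1 m _))).trans ((hb1 z hz).trans ?_)
      exact mul_le_mul_of_nonneg_left hz.1.2.le hD0
    · refine (ae_restrict_iff' hQo.measurableSet).2 (Eventually.of_forall fun z hz => ?_)
      refine tendsto_nhds_of_eventually_eq ?_
      filter_upwards [hev z hz] with m hm
      simp only [hφ]
      rw [hm.1, hm.2.1]
      simp
  exact tendsto_nhds_unique lim1 ((lim2.neg).congr fun m => (key m).symm)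

end Cutoff

/-! ### Even reflection in time and periodic plane waves. -/

section Reflection

/-- Time reflection on space-time. -/
def timeReflection (n : ℕ) : SpaceTime n →L[ℝ] SpaceTime n :=
  (-ContinuousLinearMap.fst ℝ ℝ (EuclideanSpace ℝ (Fin n))).prod (ContinuousLinearMap.snd ℝ ℝ _)

@[simp] theorem timeReflection_apply (z : SpaceTime n) : timeReflection n z = (-z.1, z.2) := rfl

theorem timeReflection_timeReflection (z : SpaceTime n) :
    timeReflection n (timeReflection n z) = z := by simp

theorem measurePreserving_timeReflection :
    MeasurePreserving (timeReflection n) volume volume :=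
  (Measure.measurePreserving_neg (volume : Measure ℝ)).prod
    (MeasurePreserving.id (volume : Measure (EuclideanSpace ℝ (Fin n))))

theorem integral_comp_timeReflection (f : SpaceTime n → ℂ) :
    ∫ z, f (timeReflection n z) = ∫ z, f z := by
  have hinv : Function.Involutive (timeReflection n) := timeReflection_timeReflection
  let e : SpaceTime n ≃ᵐ SpaceTime n :=
    { hinv.toPerm with
      measurable_toFun := (timeReflection n).continuous.measurable
      measurable_invFun := (timeReflection n).continuous.measurable }
  exact (measurePreserving_timeReflection (n := n)).integral_comp e.measurableEmbedding f

/-- The plane wave `z ↦ exp (i θ(z))`. -/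
def planeWave (θ : SpaceTime n →L[ℝ] ℝ) (z : SpaceTime n) : ℂ := Complex.exp (Complex.I * θ z)

theorem norm_planeWave (θ : SpaceTime n →L[ℝ] ℝ) (z : SpaceTime n) : ‖planeWave θ z‖ = 1 := by
  rw [planeWave, mul_comm]; exact Complex.norm_exp_ofReal_mul_I _

theorem contDiff_planeWave (θ : SpaceTime n →L[ℝ] ℝ) : ContDiff ℝ (⊤ : ℕ∞) (planeWave θ) :=
  Complex.contDiff_exp.comp (contDiff_const.mul (Complex.ofRealCLM.contDiff.comp θ.contDiff))

theorem fderiv_planeWave (θ : SpaceTime n →L[ℝ] ℝ) (z e : SpaceTime n) :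
    fderiv ℝ (planeWave θ) z e = Complex.I * θ e * planeWave θ z := by
  have h1 : HasFDerivAt (fun z => Complex.I * (θ z : ℂ))
      (Complex.I • (Complex.ofRealCLM.comp θ)) z :=
    (Complex.ofRealCLM.comp θ).hasFDerivAt.const_mul Complex.I
  refine (DFunLike.congr_fun h1.cexp.fderiv e).trans ?_
  simp [planeWave]
  ring

theorem planeWave_add (θ θ' : SpaceTime n →L[ℝ] ℝ) (z : SpaceTime n) :
    planeWave (θ + θ') z = planeWave θ z * planeWave θ' z := by
  simp [planeWave, mul_add, Complex.exp_add]

theorem integrable_mul_planeWave {μ : Measure (SpaceTime n)} {f : SpaceTime n → ℂ}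
    (hf : Integrable f μ) (θ : SpaceTime n →L[ℝ] ℝ) :
    Integrable (fun z => f z * planeWave θ z) μ :=
  hf.mul_bdd (c := 1) (contDiff_planeWave θ).continuous.aestronglyMeasurable
    (Eventually.of_forall fun z => (norm_planeWave θ z).le)

variable {T : ℝ} {Ω : Set (EuclideanSpace ℝ (Fin n))} {B : Set (SpaceTime n)}

/-- The reflection is moved from `f` to the plane wave by a change of variables; the box contains
both the cylinder and its mirror image, so nothing is lost in the restriction. -/
theorem setIntegral_reflection_mul (hB : ∀ t x, |t| < T → x ∈ Ω → (t, x) ∈ B)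
    {f : SpaceTime n → ℂ} (hf : Integrable f) (hf0 : ∀ z ∉ spaceTimeCylinder T Ω, f z = 0)
    (s : ℂ) (θ : SpaceTime n →L[ℝ] ℝ) :
    ∫ z in B, (f z + s * f (timeReflection n z)) * planeWave θ z =
      ∫ z in spaceTimeCylinder T Ω,
        (planeWave θ z + s * planeWave (θ.comp (timeReflection n)) z) * f z := by
  have hB' : ∀ z, z ∉ B → z ∉ spaceTimeCylinder T Ω := fun z hz hzQ => hz
    (hB z.1 z.2 (by rw [abs_of_pos hzQ.1.1]; exact hzQ.1.2) hzQ.2)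
  have hB'' : ∀ z, z ∉ B → timeReflection n z ∉ spaceTimeCylinder T Ω := fun z hz hzQ => hz
    (hB z.1 z.2 (by
      have h1 := hzQ.1.1
      have h2 := hzQ.1.2
      simp only [timeReflection_apply] at h1 h2
      rw [abs_lt]; constructor <;> linarith) hzQ.2)
  rw [setIntegral_eq_integral_of_forall_compl_eq_zero fun z hz => by
      rw [hf0 z (hB' z hz), hf0 _ (hB'' z hz)]; ring,
    setIntegral_eq_integral_of_forall_compl_eq_zero fun z hz => by rw [hf0 z hz]; ring]
  have i1 := integrable_mul_planeWave hf θ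
  have i2 := integrable_mul_planeWave hf (θ.comp (timeReflection n))
  have i3 : Integrable fun z => f (timeReflection n z) * planeWave θ z :=
    integrable_mul_planeWave (measurePreserving_timeReflection.integrable_comp_of_integrable hf) θ
  have e1 : ∫ z, f (timeReflection n z) * planeWave θ z =
      ∫ z, f z * planeWave (θ.comp (timeReflection n)) z := by
    rw [← integral_comp_timeReflection]
    refine integral_congr_ae (Eventually.of_forall fun z => ?_)
    simp [planeWave]
  calc ∫ z, (f z + s * f (timeReflection n z)) * planeWave θ z
      = ∫ z, f z * planeWave θ z + s * (f (timeReflection n z) * planeWave θ z) := by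
        congr 1; ext z; ring
    _ = ∫ z, f z * planeWave θ z + s * (f z * planeWave (θ.comp (timeReflection n)) z) := by
        rw [integral_add i1 (i3.const_mul s), integral_const_mul, e1, ← integral_const_mul,
          ← integral_add i1 (i2.const_mul s)]
    _ = _ := by congr 1; ext z; ring

/-- The even time reflection of a function has as weak time derivative the odd reflection of its
weak derivative, when tested against `2T`-periodic plane waves. -/
theorem setIntegral_reflection_eq (hΩ : IsOpen Ω) (hΩb : Bornology.IsBounded Ω)
    (hB : ∀ t x, |t| < T → x ∈ Ω → (t, x) ∈ B) {f w : SpaceTime n → ℂ}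
    (h : HasWeakDerivOn (spaceTimeCylinder T Ω) (timeDir n) f w)
    (hf : Integrable f) (hf0 : ∀ z ∉ spaceTimeCylinder T Ω, f z = 0)
    (hw : Integrable w) (hw0 : ∀ z ∉ spaceTimeCylinder T Ω, w z = 0)
    {θ : SpaceTime n →L[ℝ] ℝ} (hθ : ∃ m : ℤ, θ (timeDir n) * T = Real.pi * m) :
    Complex.I * θ (timeDir n) *
        ∫ z in B, (f z + f (timeReflection n z)) * planeWave θ z =
      -∫ z in B, (w z - w (timeReflection n z)) * planeWave θ z := by
  have hz : ∀ (t : ℝ) (x : EuclideanSpace ℝ (Fin n)),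
      ((t, x) : SpaceTime n) = t • timeDir n + (0, x) := by
    intro t x; simp [timeDir]
  -- The plane wave minus its reflection vanishes at `t = 0` by symmetry, and at `t = T` because `τ
  -- T` is a multiple of `π`, so that `exp (iτT) = exp (-iτT)`.
  have key := integral_fderiv_timeDir_mul_eq hΩ hΩb h hf.restrict hw.restrict
    (ψ := fun z => planeWave θ z - planeWave (θ.comp (timeReflection n)) z)
    ((contDiff_planeWave θ).sub (contDiff_planeWave _)) ?_ ?_
    (D := 2 * |θ (timeDir n)|) ?_
  · have h1 := setIntegral_reflection_mul hB hf hf0 1 θ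
    have h2 := setIntegral_reflection_mul hB hw hw0 (-1) θ
    simp only [one_mul, neg_mul, ← sub_eq_add_neg] at h1 h2
    rw [h1, h2, ← key, ← integral_const_mul]
    congr 1
    ext z
    rw [fderiv_fun_sub ((contDiff_planeWave _).differentiable (by simp) z)
      ((contDiff_planeWave _).differentiable (by simp) z)]
    simp only [sub_apply, fderiv_planeWave]
    have : (θ.comp (timeReflection n)) (timeDir n) = -θ (timeDir n) := by
      rw [← map_neg]
      simp [timeDir]
    rw [this]
    push_cast
    ring
  · intro x
    simp [planeWave]
  · intro x
    obtain ⟨m, hm⟩ := hθ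
    simp only [planeWave, ContinuousLinearMap.comp_apply, timeReflection_apply]
    rw [sub_eq_zero, Complex.exp_eq_exp_iff_exists_int]
    refine ⟨m, ?_⟩
    rw [hz T x, hz (-T) x]
    simp only [map_add, map_smul, smul_eq_mul]
    have hm' : ((θ (timeDir n) : ℝ) : ℂ) * T = Real.pi * m := by exact_mod_cast hm
    push_cast
    linear_combination (2 * Complex.I) * hm'
  · intro z
    rw [fderiv_fun_sub ((contDiff_planeWave _).differentiable (by simp) z)
      ((contDiff_planeWave _).differentiable (by simp) z)]
    simp only [sub_apply, fderiv_planeWave]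
    have : (θ.comp (timeReflection n)) (timeDir n) = -θ (timeDir n) := by
      rw [← map_neg]
      simp [timeDir]
    rw [this]
    refine (norm_sub_le _ _).trans ?_
    simp only [norm_mul, norm_planeWave, Complex.norm_I, Complex.norm_real, Real.norm_eq_abs,
      abs_neg]
    linarith

end Reflection

section BoundedRepresentative

/-- A representative bounded at every point and zero off `Q` can be reflected, and defines a
multiplication operator on `L²` of the box. -/
theorem exists_bounded_representative {Q : Set (SpaceTime n)} (hQ : MeasurableSet Q)
    {f : SpaceTime n → ℂ} (hf : MemLp f ∞ (volume.restrict Q)) :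
    ∃ (f' : SpaceTime n → ℂ) (M : ℝ), Measurable f' ∧ 0 ≤ M ∧ (∀ z, ‖f' z‖ ≤ M) ∧
      (∀ z ∉ Q, f' z = 0) ∧ f =ᵐ[volume.restrict Q] f' := by
  obtain ⟨g, hgm, hg⟩ := hf.1
  have hgM := hf.2
  rw [eLpNorm_exponent_top] at hgM
  set M := (eLpNormEssSup f (volume.restrict Q)).toReal with hM
  have hgm' := hgm.measurable
  have hfM : ∀ᵐ z ∂(volume.restrict Q), ‖f z‖ ≤ M := by
    filter_upwards [ae_le_eLpNormEssSup (f := f) (μ := volume.restrict Q)] with z hz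
    rw [← toReal_enorm]
    exact ENNReal.toReal_mono hgM.ne hz
  have hS : MeasurableSet (Q ∩ {z | ‖g z‖ ≤ M}) :=
    hQ.inter (measurableSet_le hgm'.norm measurable_const)
  refine ⟨(Q ∩ {z | ‖g z‖ ≤ M}).indicator g, M, hgm'.indicator hS, ENNReal.toReal_nonneg,
    fun z => ?_, fun z hz => indicator_of_notMem (fun h => hz h.1) _, ?_⟩
  · by_cases hz : z ∈ Q ∩ {z | ‖g z‖ ≤ M}
    · rw [indicator_of_mem hz]; exact hz.2
    · rw [indicator_of_notMem hz, norm_zero]; exact ENNReal.toReal_nonneg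
  · filter_upwards [hg, hfM, ae_restrict_mem hQ] with z h1 h2 h3
    have h4 : z ∈ Q ∩ {z | ‖g z‖ ≤ M} := ⟨h3, by rw [mem_ofPred_eq, ← h1]; exact h2⟩
    rw [indicator_of_mem h4, h1]

end BoundedRepresentative

end WaveCGO

/-! ### Multipliers in a Hilbert basis and the contraction argument. -/

namespace WaveCGO

open Filter Topology

section HilbertBasis

variable {ι H : Type*} [NormedAddCommGroup H] [InnerProductSpace ℂ H] (b : HilbertBasis ι ℂ H)

theorem summable_sq_repr (u : H) : Summable fun k => ‖b.repr u k‖ ^ 2 := by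
  have h := lp.memℓp (b.repr u)
  rw [memℓp_gen_iff (by simp)] at h
  simpa using h

theorem exists_repr_eq {c : ι → ℂ} (hc : Summable fun k => ‖c k‖ ^ 2) :
    ∃ u : H, ∀ k, b.repr u k = c k := by
  have h : Memℓp c 2 := by
    rw [memℓp_gen_iff (by simp)]
    simpa using hc
  exact ⟨b.repr.symm ⟨c, h⟩, fun k => by simp⟩

theorem exists_repr_eq_mul {u : H} {W : ι → ℝ} (hu : Summable fun k => (W k * ‖b.repr u k‖) ^ 2)
    {m : ι → ℂ} {C : ℝ} (hm : ∀ k, ‖m k‖ ≤ C * W k) :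
    ∃ w : H, ∀ k, b.repr w k = m k * b.repr u k := by
  refine exists_repr_eq b ((hu.mul_left (C ^ 2)).of_nonneg_of_le (fun k => by positivity)
    fun k => ?_)
  rw [norm_mul, ← mul_pow, ← mul_assoc]
  gcongr
  exact hm k

theorem exists_multiplier {m : ι → ℂ} {C : ℝ} (hC : 0 ≤ C) (hm : ∀ k, ‖m k‖ ≤ C) :
    ∃ G : H →L[ℂ] H, (∀ u, ‖G u‖ ≤ C * ‖u‖) ∧ ∀ u k, b.repr (G u) k = m k * b.repr u k := by
  have hex : ∀ u : H, ∃ w : H, ∀ k, b.repr w k = m k * b.repr u k := fun u =>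
    exists_repr_eq_mul b (W := 1) (by simpa using summable_sq_repr b u) (by simpa using hm)
  choose G hG using hex
  have hbound : ∀ u, ‖G u‖ ≤ C * ‖u‖ := by
    intro u
    rw [← b.repr.norm_map (G u), ← b.repr.norm_map u]
    refine lp.norm_le_of_forall_sum_le (p := 2) (by simp) (by positivity) fun s => ?_
    have h1 := lp.sum_rpow_le_norm_rpow (p := 2) (by simp) (b.repr u) s
    simp only [ENNReal.toReal_ofNat, Real.rpow_ofNat] at h1 ⊢
    calc ∑ k ∈ s, ‖b.repr (G u) k‖ ^ 2 ≤ ∑ k ∈ s, C ^ 2 * ‖b.repr u k‖ ^ 2 := by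
          refine Finset.sum_le_sum fun k _ => ?_
          rw [hG, norm_mul, ← mul_pow]
          have := hm k
          gcongr
      _ = C ^ 2 * ∑ k ∈ s, ‖b.repr u k‖ ^ 2 := by rw [Finset.mul_sum]
      _ ≤ C ^ 2 * ‖b.repr u‖ ^ 2 := by gcongr
      _ = (C * ‖b.repr u‖) ^ 2 := by ring
  let G' : H →ₗ[ℂ] H :=
    { toFun := G
      map_add' := fun u v => b.repr.injective (by
        ext k
        simp [hG, mul_add])
      map_smul' := fun c u => b.repr.injective (by
        ext k
        simp [hG, mul_left_comm]) }
  exact ⟨G'.mkContinuous C hbound, hbound, hG⟩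

end HilbertBasis

theorem exists_eq_add_of_contraction {E : Type*} [NormedAddCommGroup E] [NormedSpace ℂ E]
    [CompleteSpace E] (L : E →L[ℂ] E) (hL : ∀ x, ‖L x‖ ≤ 2⁻¹ * ‖x‖) (y : E) :
    ∃ x, x = L x + y ∧ ‖x‖ ≤ 2 * ‖y‖ := by
  have hc : ContractingWith 2⁻¹ fun x => L x + y := by
    refine ⟨by rw [← NNReal.coe_lt_coe]; norm_num, LipschitzWith.of_dist_le_mul fun x x' => ?_⟩
    rw [dist_add_right, dist_eq_norm, dist_eq_norm, ← map_sub]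
    simpa using hL (x - x')
  have hfix := hc.fixedPoint_isFixedPt
  set x := hc.fixedPoint with hx
  refine ⟨x, hfix.symm, ?_⟩
  have h1 : ‖x‖ ≤ 2⁻¹ * ‖x‖ + ‖y‖ := by
    calc ‖x‖ = ‖L x + y‖ := by rw [show L x + y = x from hfix]
      _ ≤ ‖L x‖ + ‖y‖ := norm_add_le _ _
      _ ≤ _ := by gcongr; exact hL x
  linarith

theorem exists_mul_bounded {α : Type*} [MeasurableSpace α] (μ : Measure α) {g : α → ℂ}
    (hg : Measurable g) {M : ℝ} (hM : ∀ z, ‖g z‖ ≤ M) :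
    ∃ A : Lp ℂ 2 μ →L[ℂ] Lp ℂ 2 μ, (∀ u, ‖A u‖ ≤ M * ‖u‖) ∧
      ∀ u, A u =ᵐ[μ] fun z => g z * u z := by
  have hmem : ∀ u : Lp ℂ 2 μ, MemLp (fun z => g z * u z) 2 μ := fun u =>
    (Lp.memLp u).of_le_mul (c := M) (hg.aestronglyMeasurable.mul (Lp.memLp u).1)
      (Eventually.of_forall fun z => by rw [norm_mul]; gcongr; exact hM z)
  have hcoe : ∀ u, (hmem u).toLp _ =ᵐ[μ] fun z => g z * u z := fun u => (hmem u).coeFn_toLp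
  have hbound : ∀ u, ‖(hmem u).toLp _‖ ≤ M * ‖u‖ := fun u => by
    refine Lp.norm_le_mul_norm_of_ae_le_mul ?_
    filter_upwards [hcoe u] with z hz
    rw [hz, norm_mul]
    gcongr
    exact hM z
  let A : Lp ℂ 2 μ →ₗ[ℂ] Lp ℂ 2 μ :=
    { toFun := fun u => (hmem u).toLp _
      map_add' := fun u v => Lp.ext (by
        filter_upwards [hcoe (u + v), hcoe u, hcoe v, Lp.coeFn_add u v,
          Lp.coeFn_add ((hmem u).toLp _) ((hmem v).toLp _)] with z h1 h2 h3 h4 h5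
        rw [h1, h5, Pi.add_apply, h2, h3, h4, Pi.add_apply]
        ring)
      map_smul' := fun c u => Lp.ext (by
        filter_upwards [hcoe (c • u), hcoe u, Lp.coeFn_smul c u,
          Lp.coeFn_smul c ((hmem u).toLp _)] with z h1 h2 h3 h4
        rw [RingHom.id_apply, h1, h4, Pi.smul_apply, h2, h3, Pi.smul_apply, smul_eq_mul,
          smul_eq_mul]
        ring) }
  exact ⟨A.mkContinuous M hbound, hbound, hcoe⟩

/-- A weakly coupled system, diagonal in a Hilbert basis up to a small perturbation. -/
theorem exists_solution_of_hilbertBasis {ι H : Type*} [NormedAddCommGroup H]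
    [InnerProductSpace ℂ H] [CompleteSpace H] (b : HilbertBasis ι ℂ H) {n : ℕ} {M N a : ℝ}
    (hM : 0 ≤ M) (hN : 0 ≤ N) (ha0 : 0 < a) (ha : 2 * (n * M) ≤ a) {p : ι → ℂ}
    (hp : ∀ k, a ≤ ‖p k‖) (A : Fin n → Fin n → H →L[ℂ] H) (hA : ∀ i j u, ‖A i j u‖ ≤ M * ‖u‖)
    (y : Fin n → H) (hy : ∀ i, ‖y i‖ ≤ N) :
    ∃ S f : Fin n → H, (∀ i, ‖S i‖ ≤ 2 * N) ∧
      (∀ i, f i = -(∑ j, A i j (S j)) - (a : ℂ) • y i) ∧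
      ∀ i k, p k * b.repr (S i) k = b.repr (f i) k := by
  obtain ⟨G, hGn, hG⟩ := exists_multiplier b (m := fun k => (p k)⁻¹) (C := a⁻¹) (by positivity)
    fun k => by
      rw [norm_inv]
      exact inv_anti₀ ha0 (hp k)
  let L : (Fin n → H) →L[ℂ] (Fin n → H) :=
    ContinuousLinearMap.pi fun i => -(G.comp (∑ j, (A i j).comp (ContinuousLinearMap.proj j)))
  have hLa : ∀ X i, L X i = -G (∑ j, A i j (X j)) := fun X i => by
    simp [L]
  have hL : ∀ X, ‖L X‖ ≤ 2⁻¹ * ‖X‖ := by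
    intro X
    refine (pi_norm_le_iff_of_nonneg (by positivity)).2 fun i => ?_
    rw [hLa, norm_neg]
    calc ‖G (∑ j, A i j (X j))‖ ≤ a⁻¹ * ‖∑ j, A i j (X j)‖ := hGn _
      _ ≤ a⁻¹ * ∑ _j : Fin n, M * ‖X‖ := by
        gcongr
        refine (norm_sum_le _ _).trans (Finset.sum_le_sum fun j _ => (hA i j _).trans ?_)
        gcongr
        exact norm_le_pi_norm X j
      _ = (a⁻¹ * (n * M)) * ‖X‖ := by simp; ring
      -- The hypothesis `2nM ≤ a` is exactly what makes the coupling a contraction of ratio `1/2`.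
      _ ≤ 2⁻¹ * ‖X‖ := by
        gcongr
        rw [inv_mul_le_iff₀ ha0]
        linarith
  -- The factor `a` of the source cancels the norm `a⁻¹` of `G`, which gives a bound independent of
  -- `a`.
  obtain ⟨S, hS, hSn⟩ := exists_eq_add_of_contraction L hL fun i => -((a : ℂ) • G (y i))
  refine ⟨S, fun i => -(∑ j, A i j (S j)) - (a : ℂ) • y i, fun i => ?_, fun i => rfl,
    fun i k => ?_⟩
  · refine (norm_le_pi_norm S i).trans (hSn.trans ?_)
    gcongr
    refine (pi_norm_le_iff_of_nonneg hN).2 fun i => ?_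
    rw [norm_neg, norm_smul, Complex.norm_real, Real.norm_of_nonneg ha0.le]
    calc a * ‖G (y i)‖ ≤ a * (a⁻¹ * N) := by
          gcongr
          refine (hGn _).trans ?_
          gcongr
          exact hy i
      _ = N := by rw [mul_inv_cancel_left₀ ha0.ne']
  · have hSG : S i = G (-(∑ j, A i j (S j)) - (a : ℂ) • y i) := by
      conv_lhs => rw [hS]
      rw [Pi.add_apply, hLa, map_sub, map_neg, map_smul, sub_eq_add_neg]
    have h0 : p k ≠ 0 := norm_pos_iff.1 (ha0.trans_le (hp k))
    conv_lhs => rw [hSG]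
    rw [hG, mul_inv_cancel_left₀ h0]

/-! ### Lower bounds for the symbol of the conjugated operator. -/

section Symbol

variable {n : ℕ}

/-- The symbol of `(∂ₜ + 1)² - Δ + 2a ((∂ₜ + 1) - ω·∇)` at the plane wave with phase `θ`. -/
def waveSymbol (a : ℝ) (ω : EuclideanSpace ℝ (Fin n)) (θ : SpaceTime n →L[ℝ] ℝ) : ℂ :=
  (1 + Complex.I * θ (timeDir n)) ^ 2 + ∑ j, (θ (spaceDir j) : ℂ) ^ 2
    + 2 * a * (1 + Complex.I * θ (timeDir n))
    - 2 * a * Complex.I * ∑ j, (ω j : ℂ) * θ (spaceDir j)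

theorem waveSymbol_re (a : ℝ) (ω : EuclideanSpace ℝ (Fin n)) (θ : SpaceTime n →L[ℝ] ℝ) :
    (waveSymbol a ω θ).re =
      1 - θ (timeDir n) ^ 2 + ∑ j, θ (spaceDir j) ^ 2 + 2 * a := by
  have h1 : ∑ j, (θ (spaceDir j) : ℂ) ^ 2 = ((∑ j, θ (spaceDir j) ^ 2 : ℝ) : ℂ) := by push_cast; rfl
  have h2 : ∑ j, (ω j : ℂ) * θ (spaceDir j) = ((∑ j, ω j * θ (spaceDir j) : ℝ) : ℂ) := by
    push_cast; rfl
  rw [waveSymbol, h1, h2]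
  simp [pow_two]

theorem waveSymbol_im (a : ℝ) (ω : EuclideanSpace ℝ (Fin n)) (θ : SpaceTime n →L[ℝ] ℝ) :
    (waveSymbol a ω θ).im =
      2 * (1 + a) * θ (timeDir n) - 2 * a * ∑ j, ω j * θ (spaceDir j) := by
  have h1 : ∑ j, (θ (spaceDir j) : ℂ) ^ 2 = ((∑ j, θ (spaceDir j) ^ 2 : ℝ) : ℂ) := by push_cast; rfl
  have h2 : ∑ j, (ω j : ℂ) * θ (spaceDir j) = ((∑ j, ω j * θ (spaceDir j) : ℝ) : ℂ) := by
    push_cast; rfl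
  rw [waveSymbol, h1, h2]
  simp [pow_two]
  ring

theorem sum_spaceDir_sq_le {a : ℝ} (ha : 0 < a) (ω : EuclideanSpace ℝ (Fin n))
    (θ : SpaceTime n →L[ℝ] ℝ) :
    ∑ j, θ (spaceDir j) ^ 2 ≤ ‖waveSymbol a ω θ‖ + θ (timeDir n) ^ 2 := by
  have h := (le_abs_self _).trans (Complex.abs_re_le_norm (waveSymbol a ω θ))
  rw [waveSymbol_re] at h
  linarith

/-- The symbol, seen as a vector of the plane, is paired with `(1 + a, τ)`, the conjugated time
derivative. The pairing is at least `(1 + a)² + τ²`, the squared length of that vector, and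
Cauchy–Schwarz concludes. -/
theorem sq_add_sq_le_norm_waveSymbol_sq {a : ℝ} (ha : 0 < a) {ω : EuclideanSpace ℝ (Fin n)}
    (hω : ‖ω‖ = 1) (θ : SpaceTime n →L[ℝ] ℝ) :
    a ^ 2 + θ (timeDir n) ^ 2 ≤ ‖waveSymbol a ω θ‖ ^ 2 := by
  set τ := θ (timeDir n) with hτ
  set N := ∑ j, θ (spaceDir j) ^ 2 with hN
  set s := ∑ j, ω j * θ (spaceDir j) with hs
  have hsN : s ^ 2 ≤ N := by
    have h1 := Finset.sum_mul_sq_le_sq_mul_sq Finset.univ (fun j => ω j) fun j => θ (spaceDir j)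
    have h2 : ∑ j, ω j ^ 2 = 1 := by
      have := EuclideanSpace.real_norm_sq_eq ω
      rw [hω] at this
      linarith
    rw [h2, one_mul] at h1
    exact h1
  have hre := waveSymbol_re a ω θ
  have him := waveSymbol_im a ω θ
  rw [← hτ, ← hN] at hre
  rw [← hτ, ← hs] at him
  set x := (waveSymbol a ω θ).re
  set y := (waveSymbol a ω θ).im
  have hnorm : ‖waveSymbol a ω θ‖ ^ 2 = x ^ 2 + y ^ 2 := by
    rw [Complex.sq_norm, Complex.normSq_apply]; ring
  rw [hnorm]
  have hN0 : 0 ≤ N := (sq_nonneg s).trans hsN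
  -- The difference of the two sides is `a(1 + a) + N + a(s - τ)² + a(N - s²)`.
  have hpair : (1 + a) ^ 2 + τ ^ 2 ≤ (1 + a) * x + τ * y := by
    rw [hre, him]
    nlinarith [mul_nonneg ha.le (sq_nonneg (s - τ)), mul_nonneg ha.le (sub_nonneg.2 hsN)]
  have hcs : ((1 + a) * x + τ * y) ^ 2 ≤ ((1 + a) ^ 2 + τ ^ 2) * (x ^ 2 + y ^ 2) := by
    nlinarith [sq_nonneg ((1 + a) * y - τ * x)]
  have hpos : 0 < (1 + a) ^ 2 + τ ^ 2 := by positivity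
  have h3 : ((1 + a) ^ 2 + τ ^ 2) * ((1 + a) ^ 2 + τ ^ 2) ≤
      ((1 + a) ^ 2 + τ ^ 2) * (x ^ 2 + y ^ 2) := by nlinarith
  have h4 := le_of_mul_le_mul_left h3 hpos
  nlinarith

theorem le_norm_waveSymbol {a : ℝ} (ha : 0 < a) {ω : EuclideanSpace ℝ (Fin n)}
    (hω : ‖ω‖ = 1) (θ : SpaceTime n →L[ℝ] ℝ) : a ≤ ‖waveSymbol a ω θ‖ :=
  (pow_le_pow_iff_left₀ ha.le (norm_nonneg _) two_ne_zero).1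
    (by nlinarith [sq_add_sq_le_norm_waveSymbol_sq ha hω θ])

theorem abs_timeDir_le_norm_waveSymbol {a : ℝ} (ha : 0 < a) {ω : EuclideanSpace ℝ (Fin n)}
    (hω : ‖ω‖ = 1) (θ : SpaceTime n →L[ℝ] ℝ) : |θ (timeDir n)| ≤ ‖waveSymbol a ω θ‖ := by
  refine abs_le_of_sq_le_sq ?_ (norm_nonneg _)
  nlinarith [sq_add_sq_le_norm_waveSymbol_sq ha hω θ]

/-- The weight `1 + τ² + |ξ|²` of the frequency `θ = (τ, ξ)`. -/
def sobolevWeight (θ : SpaceTime n →L[ℝ] ℝ) : ℝ :=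
  1 + θ (timeDir n) ^ 2 + ∑ j, θ (spaceDir j) ^ 2

theorem one_le_sobolevWeight (θ : SpaceTime n →L[ℝ] ℝ) : 1 ≤ sobolevWeight θ := by
  have : 0 ≤ ∑ j, θ (spaceDir j) ^ 2 := Finset.sum_nonneg fun j _ => sq_nonneg _
  have := sq_nonneg (θ (timeDir n))
  unfold sobolevWeight
  linarith

theorem exists_abs_le_sqrt_sobolevWeight (e : SpaceTime n) :
    ∃ C : ℝ, 0 ≤ C ∧ ∀ θ : SpaceTime n →L[ℝ] ℝ, |θ e| ≤ C * Real.sqrt (sobolevWeight θ) := by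
  refine ⟨|e.1| + ∑ j, |e.2 j|, by positivity, fun θ => ?_⟩
  have he : e = e.1 • timeDir n + ∑ j, e.2 j • spaceDir j := by
    refine Prod.ext ?_ ?_
    · simp [timeDir, spaceDir, Prod.fst_sum]
    · have := (EuclideanSpace.basisFun (Fin n) ℝ).sum_repr e.2
      simpa [timeDir, spaceDir, Prod.snd_sum] using this.symm
  have hj : ∀ j, |θ (spaceDir j)| ≤ Real.sqrt (sobolevWeight θ) := fun j => by
    refine Real.abs_le_sqrt ?_
    have := Finset.single_le_sum (f := fun j => θ (spaceDir j) ^ 2) (fun j _ => sq_nonneg _)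
      (Finset.mem_univ j)
    have := sq_nonneg (θ (timeDir n))
    unfold sobolevWeight
    simp only at *
    linarith
  have ht : |θ (timeDir n)| ≤ Real.sqrt (sobolevWeight θ) := by
    refine Real.abs_le_sqrt ?_
    have : 0 ≤ ∑ j, θ (spaceDir j) ^ 2 := Finset.sum_nonneg fun j _ => sq_nonneg _
    unfold sobolevWeight
    linarith
  conv_lhs => rw [he]
  rw [map_add, map_sum, map_smul, add_mul, Finset.sum_mul]
  refine (abs_add_le _ _).trans (add_le_add ?_ ((Finset.abs_sum_le_sum_abs _ _).trans
    (Finset.sum_le_sum fun j _ => ?_)))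
  · rw [smul_eq_mul, abs_mul]; gcongr
  · rw [map_smul, smul_eq_mul, abs_mul]; gcongr; exact hj j

end Symbol

end WaveCGO

/-! ### Weak derivatives and products in terms of Fourier coefficients. -/

namespace WaveCGO

open Filter Topology

variable {n : ℕ} {T : ℝ} {Ω : Set (EuclideanSpace ℝ (Fin n))}

namespace FourierBox

variable (F : FourierBox n T Ω)

/-- The normalised Lebesgue measure of the box. -/
abbrev μ : Measure (SpaceTime n) := F.scale • volume.restrict F.box

theorem cylinder_subset : spaceTimeCylinder T Ω ⊆ F.box := fun z hz =>
  F.mem_box z.1 z.2 (by rw [abs_of_pos hz.1.1]; exact hz.1.2) hz.2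

theorem restrict_cylinder_le :
    (volume.restrict (spaceTimeCylinder T Ω) : Measure (SpaceTime n)) ≤ F.scale⁻¹ • F.μ := by
  rw [smul_smul, ENNReal.inv_mul_cancel F.scale_ne_zero F.scale_ne_top, one_smul]
  exact Measure.restrict_mono F.cylinder_subset le_rfl

theorem absolutelyContinuous :
    (volume.restrict (spaceTimeCylinder T Ω) : Measure (SpaceTime n)) ≪ F.μ :=
  (Measure.absolutelyContinuous_of_le F.restrict_cylinder_le).trans
    (Measure.smul_absolutelyContinuous)

theorem memLp_cylinder {u : SpaceTime n → ℂ} (hu : MemLp u 2 F.μ) :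
    MemLp u 2 (volume.restrict (spaceTimeCylinder T Ω)) :=
  hu.of_measure_le_smul (ENNReal.inv_ne_top.2 F.scale_ne_zero) F.restrict_cylinder_le

theorem integral_μ (g : SpaceTime n → ℂ) :
    ∫ z, g z ∂F.μ = F.scale.toReal * ∫ z in F.box, g z := by
  rw [integral_smul_measure]
  simp

theorem coe_basis_eq (k : Fin (n + 1) → ℤ) : F.basis k =ᵐ[F.μ] planeWave (F.freq k) :=
  F.coe_basis k

theorem conj_planeWave (θ : SpaceTime n →L[ℝ] ℝ) (z : SpaceTime n) :
    (starRingEnd ℂ) (planeWave θ z) = planeWave (-θ) z := by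
  simp [planeWave, ← Complex.exp_conj]

theorem inner_eq_integral (u v : Lp ℂ 2 F.μ) :
    inner ℂ u v = ∫ z, (starRingEnd ℂ) (u z) * v z ∂F.μ := by
  rw [L2.inner_def]
  refine integral_congr_ae (Eventually.of_forall fun z => ?_)
  simp [RCLike.inner_apply, mul_comm]

theorem repr_eq_integral (u : Lp ℂ 2 F.μ) (k : Fin (n + 1) → ℤ) :
    F.basis.repr u k = ∫ z, planeWave (-F.freq k) z * u z ∂F.μ := by
  rw [HilbertBasis.repr_apply_apply, inner_eq_integral]
  refine integral_congr_ae ?_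
  filter_upwards [F.coe_basis_eq k] with z hz
  rw [hz, conj_planeWave]

/-- Functions in `L²` of the box whose Fourier coefficients differ by the symbol of a derivative
are weak derivatives of each other. -/
theorem hasWeakDerivOn (e : SpaceTime n) {u w : Lp ℂ 2 F.μ}
    (h : ∀ k, F.basis.repr w k = Complex.I * F.freq k e * F.basis.repr u k) :
    HasWeakDerivOn (spaceTimeCylinder T Ω) e u w := by
  have := F.isProbabilityMeasure
  have hfin : IsFiniteMeasure (volume.restrict (spaceTimeCylinder T Ω) : Measure (SpaceTime n)) :=
    ⟨(F.restrict_cylinder_le univ).trans_lt (by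
      rw [Measure.smul_apply, measure_univ, smul_eq_mul, mul_one]
      exact (ENNReal.inv_ne_top.2 F.scale_ne_zero).lt_top)⟩
  have hloc : ∀ v : Lp ℂ 2 F.μ, LocallyIntegrableOn v (spaceTimeCylinder T Ω) := fun v =>
    IntegrableOn.locallyIntegrableOn
      ((F.memLp_cylinder (Lp.memLp v)).integrable one_le_two)
  refine ⟨hloc u, hloc w, fun φ hφ hc hs => ?_⟩
  have hφ'c : Continuous fun z => fderiv ℝ φ z e := continuous_fderiv_dir hφ e
  have hcont : ∀ g : SpaceTime n → ℝ, Continuous g → HasCompactSupport g →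
      ∃ G : Lp ℂ 2 F.μ, G =ᵐ[F.μ] fun z => (g z : ℂ) := by
    intro g hg hgc
    have h1 : MemLp (fun z => (g z : ℂ)) 2 F.μ := by
      obtain ⟨C, hC⟩ := hgc.exists_bound_of_continuous hg
      exact MemLp.of_bound (Complex.continuous_ofReal.comp hg).aestronglyMeasurable C
        (Eventually.of_forall fun z => by simpa using hC z)
    exact ⟨h1.toLp _, h1.coeFn_toLp⟩
  obtain ⟨Φ, hΦ⟩ := hcont φ hφ.continuous hc
  obtain ⟨Φ', hΦ'⟩ := hcont _ hφ'c (hc.fderiv_apply ℝ e)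
  have hinner : ∀ (g : SpaceTime n → ℝ) (G : Lp ℂ 2 F.μ), (G =ᵐ[F.μ] fun z => (g z : ℂ)) →
      (∀ z ∉ spaceTimeCylinder T Ω, g z = 0) → ∀ v : Lp ℂ 2 F.μ,
      inner ℂ G v = F.scale.toReal * ∫ z in spaceTimeCylinder T Ω, (g z : ℂ) * v z := by
    intro g G hG hg0 v
    rw [inner_eq_integral, ← setIntegral_eq_of_subset_of_forall_sdiff_eq_zero
      F.measurableSet_box F.cylinder_subset fun z hz => by rw [hg0 z hz.2]; simp,
      ← F.integral_μ fun z => (g z : ℂ) * v z]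
    refine integral_congr_ae ?_
    filter_upwards [hG] with z hz
    rw [hz, Complex.conj_ofReal]
  have hφ0 : ∀ z ∉ spaceTimeCylinder T Ω, φ z = 0 := fun z hz =>
    image_eq_zero_of_notMem_tsupport fun h => hz (hs h)
  have hφ'0 : ∀ z ∉ spaceTimeCylinder T Ω, fderiv ℝ φ z e = 0 := fun z hz =>
    image_eq_zero_of_notMem_tsupport (f := fun z => fderiv ℝ φ z e)
      fun h => hz (hs (tsupport_fderiv_apply_subset ℝ e h))
  have hsc : (F.scale.toReal : ℂ) ≠ 0 := by
    exact_mod_cast ENNReal.toReal_ne_zero.2 ⟨F.scale_ne_zero, F.scale_ne_top⟩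
  have hbasis : ∀ (g : SpaceTime n → ℝ) (G : Lp ℂ 2 F.μ), (G =ᵐ[F.μ] fun z => (g z : ℂ)) →
      (∀ z ∉ spaceTimeCylinder T Ω, g z = 0) → ∀ k,
      inner ℂ G (F.basis k) = F.scale.toReal * ∫ z, (g z : ℂ) * planeWave (F.freq k) z := by
    intro g G hG hg0 k
    rw [hinner g G hG hg0, ← setIntegral_eq_integral_of_forall_compl_eq_zero
      (s := spaceTimeCylinder T Ω) (f := fun z => (g z : ℂ) * planeWave (F.freq k) z)
      fun z hz => by rw [hg0 z hz]; simp]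
    congr 1
    refine integral_congr_ae ?_
    filter_upwards [F.absolutelyContinuous.ae_le (F.coe_basis_eq k)] with z hz
    rw [hz]
  -- Since `φ` is supported in the cylinder, integration by parts against a plane wave takes place
  -- on the whole space and has no boundary term on the box.
  have hibp : ∀ k, inner ℂ Φ' (F.basis k) =
      -(Complex.I * F.freq k e) * inner ℂ Φ (F.basis k) := by
    intro k
    rw [hbasis _ _ hΦ' hφ'0, hbasis _ _ hΦ hφ0]
    have hφC : ContDiff ℝ (⊤ : ℕ∞) fun z => (φ z : ℂ) := Complex.ofRealCLM.contDiff.comp hφ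
    have hcC : HasCompactSupport fun z => (φ z : ℂ) := hc.comp_left Complex.ofReal_zero
    have hfd : ∀ z, fderiv ℝ (fun z => (φ z : ℂ)) z e = ((fderiv ℝ φ z e : ℝ) : ℂ) := fun z => by
      have := (Complex.ofRealCLM.hasFDerivAt).comp z
        ((hφ.differentiable (by simp)) z).hasFDerivAt
      exact DFunLike.congr_fun this.fderiv e
    have hW := contDiff_planeWave (F.freq k)
    have h1 := integral_mul_fderiv_eq_neg_fderiv_mul_of_integrable (𝕜 := ℂ) (μ := volume)
      (f := fun z => (φ z : ℂ)) (g := planeWave (F.freq k)) (v := e) ?_ ?_ ?_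
      (fun z _ => (hφC.differentiable (by simp)) z) (fun z _ => (hW.differentiable (by simp)) z)
    · simp only [hfd, fderiv_planeWave] at h1
      rw [← neg_eq_iff_eq_neg.2 h1]
      simp only [mul_left_comm _ (Complex.I * (F.freq k e : ℂ))]
      rw [integral_const_mul]
      ring
    · simp only [hfd]
      exact ((Complex.continuous_ofReal.comp hφ'c).mul hW.continuous).integrable_of_hasCompactSupport
        (HasCompactSupport.mul_right ((hc.fderiv_apply ℝ e).comp_left Complex.ofReal_zero))
    · exact (hφC.continuous.mul ((hW.continuous_fderiv (by simp)).clm_apply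
        continuous_const)).integrable_of_hasCompactSupport hcC.mul_right
    · exact (hφC.continuous.mul hW.continuous).integrable_of_hasCompactSupport hcC.mul_right
  -- Parseval reduces the identity for `u` and `w` to the one for each basis function.
  have hsum : inner ℂ Φ' u = -inner ℂ Φ w := by
    have h1 := F.basis.hasSum_inner_mul_inner Φ' u
    have h2 := (F.basis.hasSum_inner_mul_inner Φ w).neg
    refine h1.unique (h2.congr_fun fun k => ?_)
    rw [hibp, ← HilbertBasis.repr_apply_apply, ← HilbertBasis.repr_apply_apply, h]
    ring
  rw [hinner _ _ hΦ' hφ'0, hinner _ _ hΦ hφ0, ← mul_neg] at hsum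
  exact mul_left_cancel₀ hsc hsum

/-- Fourier coefficients of a product. -/
theorem hasSum_repr_mul {g : SpaceTime n → ℂ} (hg : Measurable g) {M : ℝ}
    (hM : ∀ z, ‖g z‖ ≤ M) {u v : Lp ℂ 2 F.μ} (hv : v =ᵐ[F.μ] fun z => g z * u z)
    (k : Fin (n + 1) → ℤ) :
    HasSum (fun j => (∫ z, g z * planeWave (F.freq (j - k)) z ∂F.μ) * F.basis.repr u j)
      (F.basis.repr v k) := by
  -- Multiplication by `g` is moved to the basis vector as its adjoint, so that Parseval produces
  -- the convolution series.
  obtain ⟨A, -, hA⟩ := exists_mul_bounded F.μ (g := fun z => (starRingEnd ℂ) (g z))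
    (Complex.continuous_conj.measurable.comp hg) (M := M) (by simpa using hM)
  have h1 : F.basis.repr v k = inner ℂ (A (F.basis k)) u := by
    rw [repr_eq_integral, inner_eq_integral]
    refine integral_congr_ae ?_
    filter_upwards [hv, hA (F.basis k), F.coe_basis_eq k] with z h1 h2 h3
    rw [h1, h2, h3, map_mul, conj_planeWave, Complex.conj_conj]
    ring
  rw [h1]
  refine (F.basis.hasSum_inner_mul_inner (A (F.basis k)) u).congr_fun fun j => ?_
  rw [← HilbertBasis.repr_apply_apply]
  congr 1
  rw [inner_eq_integral]
  refine integral_congr_ae ?_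
  filter_upwards [hA (F.basis k), F.coe_basis_eq k, F.coe_basis_eq j] with z h2 h3 h4
  rw [h2, h3, h4, map_mul, conj_planeWave, Complex.conj_conj, F.freq_sub, sub_eq_add_neg,
    planeWave_add]
  ring

/-- `g` is a bounded function with a bounded time derivative `g'` in the periodic sense. -/
structure IsTimeLipschitz (g g' : SpaceTime n → ℂ) (M : ℝ) : Prop where
  measurable : Measurable g
  measurable_deriv : Measurable g'
  norm_le : ∀ z, ‖g z‖ ≤ M
  exists_norm_deriv_le : ∃ M', ∀ z, ‖g' z‖ ≤ M'
  integral_eq : ∀ k, Complex.I * F.freq k (timeDir n) * ∫ z, g z * planeWave (F.freq k) z ∂F.μ =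
    -∫ z, g' z * planeWave (F.freq k) z ∂F.μ

/-- Leibniz rule for the time derivative, in Fourier coefficients. -/
theorem IsTimeLipschitz.repr_mul {F : FourierBox n T Ω} {g g' : SpaceTime n → ℂ} {M : ℝ}
    (hg : F.IsTimeLipschitz g g' M) {u ut v v' : Lp ℂ 2 F.μ}
    (hut : ∀ k, F.basis.repr ut k = Complex.I * F.freq k (timeDir n) * F.basis.repr u k)
    (hv : v =ᵐ[F.μ] fun z => g z * u z)
    (hv' : v' =ᵐ[F.μ] fun z => g' z * u z + g z * ut z) (k : Fin (n + 1) → ℤ) :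
    Complex.I * F.freq k (timeDir n) * F.basis.repr v k = F.basis.repr v' k := by
  obtain ⟨M', hM'⟩ := hg.exists_norm_deriv_le
  obtain ⟨A, -, hA⟩ := exists_mul_bounded F.μ hg.measurable hg.norm_le
  obtain ⟨A', -, hA'⟩ := exists_mul_bounded F.μ hg.measurable_deriv hM'
  have hv'' : v' = A' u + A ut := by
    apply Lp.ext
    filter_upwards [hv', hA' u, hA ut, Lp.coeFn_add (A' u) (A ut)] with z h1 h2 h3 h4
    rw [h4, Pi.add_apply, h1, h2, h3]
  have s1 := (F.hasSum_repr_mul hg.measurable hg.norm_le hv k).mul_left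
    (Complex.I * F.freq k (timeDir n))
  have s2 := (F.hasSum_repr_mul hg.measurable_deriv hM' (hA' u) k).add
    (F.hasSum_repr_mul hg.measurable hg.norm_le (hA ut) k)
  rw [hv'', map_add, lp.coeFn_add, Pi.add_apply]
  refine s1.unique (s2.congr_fun fun j => ?_)
  have h := hg.integral_eq (j - k)
  rw [hut]
  -- Termwise, the Leibniz rule is the splitting of the frequency of `k` into that of `j` minus that
  -- of `j - k`: the first falls on `u`, the second on `g`.
  rw [F.freq_sub, sub_apply, Complex.ofReal_sub, ← F.freq_sub] at h
  linear_combination (-F.basis.repr u j) * h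

end FourierBox

end WaveCGO

/-! ### Extension of the coefficients, and solution of the system on the box. -/

namespace WaveCGO

open Filter Topology

variable {n : ℕ} {T : ℝ} {Ω : Set (EuclideanSpace ℝ (Fin n))}

namespace FourierBox

variable (F : FourierBox n T Ω)

theorem IsTimeLipschitz.mono {F : FourierBox n T Ω} {g g' : SpaceTime n → ℂ} {M N : ℝ}
    (h : F.IsTimeLipschitz g g' M) (hMN : M ≤ N) : F.IsTimeLipschitz g g' N :=
  { h with norm_le := fun z => (h.norm_le z).trans hMN }

/-- A function in `W^{1,∞}` of the cylinder extends to the box by even reflection in time and by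
zero in space, keeping a bounded time derivative. -/
theorem exists_isTimeLipschitz_extension (hΩ : IsOpen Ω) (hΩb : Bornology.IsBounded Ω)
    {f : SpaceTime n → ℂ} (hf : MemSobolev 1 ∞ (spaceTimeCylinder T Ω) f) :
    ∃ g g' M, 0 ≤ M ∧ F.IsTimeLipschitz g g' M ∧
      f =ᵐ[volume.restrict (spaceTimeCylinder T Ω)] g := by
  have hQm : MeasurableSet (spaceTimeCylinder T Ω) := (isOpen_Ioo.prod hΩ).measurableSet
  have hQb : Bornology.IsBounded (spaceTimeCylinder T Ω) := (Metric.isBounded_Ioo 0 T).prod hΩb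
  obtain ⟨w, hw, hwm⟩ := hf.2 (timeDir n)
  obtain ⟨f₁, M, hf₁m, hM0, hf₁M, hf₁0, hff₁⟩ := exists_bounded_representative hQm hf.1
  obtain ⟨w₁, M', hw₁m, hM'0, hw₁M, hw₁0, hww₁⟩ := exists_bounded_representative hQm hwm
  have hint : ∀ (h : SpaceTime n → ℂ) (C : ℝ), Measurable h → (∀ z, ‖h z‖ ≤ C) →
      (∀ z ∉ spaceTimeCylinder T Ω, h z = 0) → Integrable h := by
    intro h C hm hC h0
    have h1 : IntegrableOn h (spaceTimeCylinder T Ω) :=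
      Measure.integrableOn_of_bounded hQb.measure_lt_top.ne hm.aestronglyMeasurable
        (Eventually.of_forall hC)
    rw [← integrableOn_univ]
    exact h1.of_forall_sdiff_eq_zero MeasurableSet.univ fun z hz => h0 z hz.2
  have hρ : Measurable (timeReflection n) := (timeReflection n).continuous.measurable
  refine ⟨fun z => f₁ z + f₁ (timeReflection n z), fun z => w₁ z - w₁ (timeReflection n z),
    M + M, by positivity, ⟨hf₁m.add (hf₁m.comp hρ), hw₁m.sub (hw₁m.comp hρ),
      fun z => (norm_add_le _ _).trans (add_le_add (hf₁M _) (hf₁M _)),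
      ⟨M' + M', fun z => (norm_sub_le _ _).trans (add_le_add (hw₁M _) (hw₁M _))⟩, fun k => ?_⟩, ?_⟩
  · rw [integral_μ, integral_μ, mul_left_comm,
      setIntegral_reflection_eq hΩ hΩb F.mem_box (hw.congr_ae hff₁ hww₁) (hint _ _ hf₁m hf₁M hf₁0)
        hf₁0 (hint _ _ hw₁m hw₁M hw₁0) hw₁0 (F.freq_time k), mul_neg]
  · filter_upwards [hff₁, ae_restrict_mem hQm] with z hz hzQ
    have : f₁ (timeReflection n z) = 0 := hf₁0 _ fun h => by
      have h1 := h.1.1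
      have h2 := hzQ.1.1
      simp only [timeReflection_apply] at h1
      linarith
    rw [this, add_zero, hz]

theorem basis_zero_eq_one : F.basis 0 =ᵐ[F.μ] fun _ => 1 := by
  filter_upwards [F.coe_basis_eq 0] with z hz
  rw [hz, F.freq_zero]
  simp [planeWave]

theorem coeFn_sum_Lp {α ι : Type*} [MeasurableSpace α] {μ : Measure α} (s : Finset ι)
    (u : ι → Lp ℂ 2 μ) : (∑ j ∈ s, u j : Lp ℂ 2 μ) =ᵐ[μ] fun z => ∑ j ∈ s, u j z := by
  classical
  induction s using Finset.induction_on with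
  | empty =>
    filter_upwards [Lp.coeFn_zero ℂ 2 μ] with z hz
    rw [Finset.sum_empty, hz, Pi.zero_apply, Finset.sum_empty]
  | insert a s ha ih =>
    rw [Finset.sum_insert ha]
    filter_upwards [Lp.coeFn_add (u a) (∑ j ∈ s, u j), ih] with z h1 h2
    rw [h1, Pi.add_apply, h2, Finset.sum_insert ha]

/-- Elliptic-type gain: if the right hand side has a time derivative in `L²`, the solution has all
second derivatives in `L²`. -/
theorem summable_sobolevWeight {a : ℝ} (ha : 0 < a) {ω : EuclideanSpace ℝ (Fin n)} (hω : ‖ω‖ = 1)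
    {u f f' : Lp ℂ 2 F.μ}
    (hu : ∀ k, waveSymbol a ω (F.freq k) * F.basis.repr u k = F.basis.repr f k)
    (hf : ∀ k, Complex.I * F.freq k (timeDir n) * F.basis.repr f k = F.basis.repr f' k) :
    Summable fun k => (sobolevWeight (F.freq k) * ‖F.basis.repr u k‖) ^ 2 := by
  -- The constants come from `b4` and `(x + y)² ≤ 2x² + 2y²`.
  refine (((summable_sq_repr F.basis f).mul_left (2 * (1 + a⁻¹) ^ 2)).add
    ((summable_sq_repr F.basis f').mul_left 8)).of_nonneg_of_le (fun k => by positivity)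
    fun k => ?_
  set θ := F.freq k
  set c := ‖F.basis.repr u k‖ with hc
  have hc0 : 0 ≤ c := norm_nonneg _
  set y := ‖F.basis.repr f k‖ with hy
  have e1 : ‖waveSymbol a ω θ‖ * c = y := by rw [hy, ← hu, norm_mul]
  have e2 : |θ (timeDir n)| * y = ‖F.basis.repr f' k‖ := by
    rw [← hf, norm_mul, norm_mul, Complex.norm_I, Complex.norm_real, one_mul, Real.norm_eq_abs]
  have b1 : c ≤ a⁻¹ * y := by
    rw [inv_mul_eq_div, le_div_iff₀ ha, mul_comm, ← e1]
    exact mul_le_mul_of_nonneg_right (le_norm_waveSymbol ha hω θ) hc0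
  have b2 : θ (timeDir n) ^ 2 * c ≤ |θ (timeDir n)| * y := by
    rw [← sq_abs, pow_two, mul_assoc, ← e1]
    gcongr
    exact abs_timeDir_le_norm_waveSymbol ha hω θ
  have b3 : (∑ j, θ (spaceDir j) ^ 2) * c ≤ y + |θ (timeDir n)| * y := by
    refine (mul_le_mul_of_nonneg_right (sum_spaceDir_sq_le ha ω θ) hc0).trans ?_
    rw [add_mul, e1]
    linarith
  have b4 : sobolevWeight θ * c ≤ (1 + a⁻¹) * y + 2 * (|θ (timeDir n)| * y) := by
    unfold sobolevWeight
    linarith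
  rw [e2] at b4
  have h0 : 0 ≤ sobolevWeight θ * c :=
    mul_nonneg (zero_le_one.trans (one_le_sobolevWeight θ)) hc0
  refine (pow_le_pow_left₀ h0 b4 2).trans ?_
  nlinarith [sq_nonneg ((1 + a⁻¹) * y - 2 * ‖F.basis.repr f' k‖)]

/-- The first gain, from `|τ| ≤ |P|`: it needs no regularity of `f`, and so starts the bootstrap. -/
theorem exists_timeDeriv {a : ℝ} (ha : 0 < a) {ω : EuclideanSpace ℝ (Fin n)} (hω : ‖ω‖ = 1)
    {u f : Lp ℂ 2 F.μ}
    (hu : ∀ k, waveSymbol a ω (F.freq k) * F.basis.repr u k = F.basis.repr f k) :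
    ∃ w : Lp ℂ 2 F.μ, ∀ k,
      F.basis.repr w k = Complex.I * F.freq k (timeDir n) * F.basis.repr u k := by
  refine exists_repr_eq F.basis ((summable_sq_repr F.basis f).of_nonneg_of_le
    (fun k => by positivity) fun k => ?_)
  rw [← hu, norm_mul, norm_mul, norm_mul, Complex.norm_I, one_mul, Complex.norm_real]
  gcongr
  exact abs_timeDir_le_norm_waveSymbol ha hω _

/-- The constant `1` has zero time derivative. The source term is treated as a product with `1`, so
that the Leibniz rule covers it too. -/
theorem repr_timeDeriv_one (k : Fin (n + 1) → ℤ) :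
    F.basis.repr (0 : Lp ℂ 2 F.μ) k =
      Complex.I * F.freq k (timeDir n) * F.basis.repr (F.basis 0) k := by
  classical
  rw [HilbertBasis.repr_self]
  by_cases hk : k = 0
  · subst hk; simp [F.freq_zero]
  · simp [lp.single_apply, hk]

/-- Solvability of the conjugated wave system on the box, with a bound independent of `a`. -/
theorem exists_system_solution {ω : EuclideanSpace ℝ (Fin n)} (hω : ‖ω‖ = 1) {M N : ℝ}
    (hM : 0 ≤ M) (hN : 0 ≤ N) {g g' : Fin n → Fin n → SpaceTime n → ℂ}
    (hg : ∀ i j, F.IsTimeLipschitz (g i j) (g' i j) M) {r r' : Fin n → SpaceTime n → ℂ}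
    (hr : ∀ i, F.IsTimeLipschitz (r i) (r' i) N) {a : ℝ} (ha0 : 0 < a) (ha : 2 * (n * M) ≤ a) :
    ∃ S f : Fin n → Lp ℂ 2 F.μ, (∀ i, ‖S i‖ ≤ 2 * N) ∧
      (∀ i, f i =ᵐ[F.μ] fun z => -(∑ j, g i j z * S j z) - a * r i z) ∧
      (∀ i k, waveSymbol a ω (F.freq k) * F.basis.repr (S i) k = F.basis.repr (f i) k) ∧
      ∀ i, Summable fun k => (sobolevWeight (F.freq k) * ‖F.basis.repr (S i) k‖) ^ 2 := by
  choose M' hM' using fun i j => (hg i j).exists_norm_deriv_le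
  choose N' hN' using fun i => (hr i).exists_norm_deriv_le
  choose A hAn hA using fun i j => exists_mul_bounded F.μ (hg i j).measurable (hg i j).norm_le
  choose A' _ hA' using fun i j => exists_mul_bounded F.μ (hg i j).measurable_deriv (hM' i j)
  choose B hBn hB using fun i => exists_mul_bounded F.μ (hr i).measurable (hr i).norm_le
  choose B' _ hB' using fun i => exists_mul_bounded F.μ (hr i).measurable_deriv (hN' i)
  have he₀n : ‖F.basis 0‖ = 1 := F.basis.orthonormal.1 0
  obtain ⟨S, f, hSn, hf, hrepr⟩ := exists_solution_of_hilbertBasis F.basis hM hN ha0 ha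
    (p := fun k => waveSymbol a ω (F.freq k)) (fun k => le_norm_waveSymbol ha0 hω _) A hAn
    (fun i => B i (F.basis 0)) fun i => by simpa [he₀n] using hBn i (F.basis 0)
  refine ⟨S, f, hSn, fun i => ?_, hrepr, fun i => ?_⟩
  · have hAall : ∀ᵐ z ∂F.μ, ∀ j, A i j (S j) z = g i j z * S j z :=
      ae_all_iff.2 fun j => hA i j (S j)
    rw [hf]
    filter_upwards [Lp.coeFn_sub (-(∑ j, A i j (S j))) ((a : ℂ) • B i (F.basis 0)),
      Lp.coeFn_neg (∑ j, A i j (S j)), coeFn_sum_Lp Finset.univ fun j => A i j (S j),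
      Lp.coeFn_smul (a : ℂ) (B i (F.basis 0)), hB i (F.basis 0), F.basis_zero_eq_one, hAall]
      with z h1 h2 h3 h4 h5 h6 h7
    rw [h1, Pi.sub_apply, h2, Pi.neg_apply, h3, h4, Pi.smul_apply, h5, h6, mul_one,
      smul_eq_mul]
    simp only [h7]
  -- Bootstrap: the time derivative of `S` lies in `L²`, hence so does that of the right hand side,
  -- which is `f'` below.
  · choose St hSt using fun j => F.exists_timeDeriv ha0 hω (hrepr j)
    have hA1 : ∀ j k, Complex.I * F.freq k (timeDir n) * F.basis.repr (A i j (S j)) k =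
        F.basis.repr (A' i j (S j) + A i j (St j)) k := fun j k =>
      (hg i j).repr_mul (hSt j) (hA i j _) (by
        filter_upwards [Lp.coeFn_add (A' i j (S j)) (A i j (St j)), hA' i j (S j),
          hA i j (St j)] with z h1 h2 h3
        rw [h1, Pi.add_apply, h2, h3]) k
    have hB1 : ∀ k, Complex.I * F.freq k (timeDir n) * F.basis.repr (B i (F.basis 0)) k =
        F.basis.repr (B' i (F.basis 0)) k :=
      (hr i).repr_mul F.repr_timeDeriv_one (hB i _) (by
        filter_upwards [hB' i (F.basis 0), Lp.coeFn_zero ℂ 2 F.μ] with z h1 h2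
        rw [h1, h2, Pi.zero_apply, mul_zero, add_zero])
    refine F.summable_sobolevWeight ha0 hω (hrepr i)
      (f' := -(∑ j, (A' i j (S j) + A i j (St j))) - (a : ℂ) • B' i (F.basis 0)) fun k => ?_
    rw [hf]
    simp only [map_sub, map_neg, map_sum, map_smul, lp.coeFn_sub, lp.coeFn_neg, lp.coeFn_smul,
      lp.coeFn_sum, Pi.sub_apply, Pi.neg_apply, Pi.smul_apply, Finset.sum_apply, smul_eq_mul]
    rw [mul_sub, mul_neg, Finset.mul_sum, mul_left_comm, hB1]
    simp only [hA1]

end FourierBox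

end WaveCGO

/-! ### From Fourier coefficients back to the differential equation. -/

namespace WaveCGO

open Filter Topology

variable {n : ℕ} {T : ℝ} {Ω : Set (EuclideanSpace ℝ (Fin n))}

theorem coeFn_wave_combination {α : Type*} [MeasurableSpace α] {μ : Measure α}
    (x y u : Lp ℂ 2 μ) (p d : Fin n → Lp ℂ 2 μ) (c₁ c₂ : ℂ) (c : Fin n → ℂ) :
    (x + c₁ • y + c₂ • u - ∑ j, (p j + c j • d j) : Lp ℂ 2 μ) =ᵐ[μ]
      fun z => x z + c₁ * y z + c₂ * u z - ∑ j, (p j z + c j * d j z) := by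
  have h0 : ∀ᵐ z ∂μ, ∀ j, (p j + c j • d j : Lp ℂ 2 μ) z = p j z + c j * d j z :=
    ae_all_iff.2 fun j => by
      filter_upwards [Lp.coeFn_add (p j) (c j • d j), Lp.coeFn_smul (c j) (d j)] with z h1 h2
      rw [h1, Pi.add_apply, h2, Pi.smul_apply, smul_eq_mul]
  filter_upwards [h0, Lp.coeFn_sub (x + c₁ • y + c₂ • u) (∑ j, (p j + c j • d j)),
    Lp.coeFn_add (x + c₁ • y) (c₂ • u), Lp.coeFn_add x (c₁ • y), Lp.coeFn_smul c₁ y,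
    Lp.coeFn_smul c₂ u, FourierBox.coeFn_sum_Lp Finset.univ fun j => p j + c j • d j]
    with z h1 h2 h3 h4 h5 h6 h7
  rw [h2, Pi.sub_apply, h3, Pi.add_apply, h4, Pi.add_apply, h5, h6, h7]
  simp only [Pi.smul_apply, smul_eq_mul, h1]

/-- The coefficients come from the expansion `(∂ₜ + 1)² + 2a(∂ₜ + 1) = ∂ₜ² + 2(1 + a)∂ₜ + (1 + 2a)`.
-/
theorem eq_of_repr_waveSymbol {ι H : Type*} [NormedAddCommGroup H] [InnerProductSpace ℂ H]
    (b : HilbertBasis ι ℂ H) (θ : ι → SpaceTime n →L[ℝ] ℝ) {a : ℝ}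
    {ω : EuclideanSpace ℝ (Fin n)} {u f y x : H} {d p : Fin n → H}
    (hf : ∀ k, waveSymbol a ω (θ k) * b.repr u k = b.repr f k)
    (hy : ∀ k, b.repr y k = Complex.I * θ k (timeDir n) * b.repr u k)
    (hx : ∀ k, b.repr x k = Complex.I * θ k (timeDir n) * b.repr y k)
    (hd : ∀ j k, b.repr (d j) k = Complex.I * θ k (spaceDir j) * b.repr u k)
    (hp : ∀ j k, b.repr (p j) k = Complex.I * θ k (spaceDir j) * b.repr (d j) k) :
    x + (2 * (1 + a) : ℂ) • y + (1 + 2 * a : ℂ) • u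
      - ∑ j, (p j + (2 * a * ω j : ℂ) • d j) = f := by
  apply b.repr.injective
  ext k
  rw [← hf]
  simp only [map_sub, map_add, map_sum, map_smul, lp.coeFn_sub, lp.coeFn_add, lp.coeFn_smul,
    lp.coeFn_sum, Pi.sub_apply, Pi.add_apply, Pi.smul_apply, Finset.sum_apply, smul_eq_mul,
    hx, hy, hp, hd]
  generalize b.repr u k = c
  have e1 : ∀ j, Complex.I * (θ k (spaceDir j) : ℂ) * (Complex.I * (θ k (spaceDir j) : ℂ) * c) +
      2 * (a : ℂ) * (ω j : ℂ) * (Complex.I * (θ k (spaceDir j) : ℂ) * c) =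
      -((θ k (spaceDir j) : ℂ) ^ 2 * c) +
        (ω j : ℂ) * θ k (spaceDir j) * (2 * a * Complex.I * c) := fun j => by
    linear_combination ((θ k (spaceDir j) : ℂ) ^ 2 * c) * Complex.I_sq
  simp only [e1]
  rw [Finset.sum_add_distrib, Finset.sum_neg_distrib, ← Finset.sum_mul, ← Finset.sum_mul,
    waveSymbol]
  ring

namespace FourierBox

variable (F : FourierBox n T Ω)

/-- Each derivative costs at most a constant times the square root of the weight, so two of them are
paid for by the weight itself. -/
theorem exists_weakDeriv_two {u : Lp ℂ 2 F.μ}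
    (hu : Summable fun k => (sobolevWeight (F.freq k) * ‖F.basis.repr u k‖) ^ 2)
    (e : SpaceTime n) :
    ∃ w : Lp ℂ 2 F.μ, (∀ k, F.basis.repr w k = Complex.I * F.freq k e * F.basis.repr u k) ∧
      ∀ e' : SpaceTime n, ∃ w' : Lp ℂ 2 F.μ,
        ∀ k, F.basis.repr w' k = Complex.I * F.freq k e' * F.basis.repr w k := by
  obtain ⟨C, hC0, hC⟩ := exists_abs_le_sqrt_sobolevWeight e
  obtain ⟨w, hw⟩ := exists_repr_eq_mul F.basis hu (m := fun k => Complex.I * F.freq k e) (C := C)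
    fun k => by
      rw [norm_mul, Complex.norm_I, one_mul, Complex.norm_real]
      refine (hC _).trans (mul_le_mul_of_nonneg_left ?_ hC0)
      have h1 := one_le_sobolevWeight (F.freq k)
      exact Real.sqrt_le_iff.2 ⟨zero_le_one.trans h1, by nlinarith⟩
  refine ⟨w, hw, fun e' => ?_⟩
  obtain ⟨C', hC'0, hC'⟩ := exists_abs_le_sqrt_sobolevWeight e'
  obtain ⟨w', hw'⟩ := exists_repr_eq_mul F.basis hu
    (m := fun k => Complex.I * F.freq k e' * (Complex.I * F.freq k e)) (C := C' * C) fun k => by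
      rw [norm_mul, norm_mul, norm_mul, Complex.norm_I, one_mul, one_mul, Complex.norm_real,
        Complex.norm_real, Real.norm_eq_abs, Real.norm_eq_abs]
      calc |F.freq k e'| * |F.freq k e|
          ≤ (C' * Real.sqrt (sobolevWeight (F.freq k))) *
            (C * Real.sqrt (sobolevWeight (F.freq k))) := by
            gcongr
            · exact hC' _
            · exact hC _
        _ = C' * C * (Real.sqrt (sobolevWeight (F.freq k)) *
            Real.sqrt (sobolevWeight (F.freq k))) := by ring
        _ = _ := by
          rw [Real.mul_self_sqrt (zero_le_one.trans (one_le_sobolevWeight _))]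
  exact ⟨w', fun k => by rw [hw', hw]; ring⟩

theorem memSobolev_two {u : Lp ℂ 2 F.μ}
    (hu : Summable fun k => (sobolevWeight (F.freq k) * ‖F.basis.repr u k‖) ^ 2) :
    MemSobolev 2 2 (spaceTimeCylinder T Ω) u := by
  refine ⟨F.memLp_cylinder (Lp.memLp u), fun e => ?_⟩
  obtain ⟨w, hw, hw2⟩ := F.exists_weakDeriv_two hu e
  refine ⟨w, F.hasWeakDerivOn e hw, F.memLp_cylinder (Lp.memLp w), fun e' => ?_⟩
  obtain ⟨w', hw'⟩ := hw2 e'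
  exact ⟨w', F.hasWeakDerivOn e' hw', F.memLp_cylinder (Lp.memLp w')⟩

/-- A relation between Fourier coefficients through `waveSymbol` is a differential equation. -/
theorem exists_wave_eq {a : ℝ} {ω : EuclideanSpace ℝ (Fin n)} {u f : Lp ℂ 2 F.μ}
    (hu : Summable fun k => (sobolevWeight (F.freq k) * ‖F.basis.repr u k‖) ^ 2)
    (hf : ∀ k, waveSymbol a ω (F.freq k) * F.basis.repr u k = F.basis.repr f k) :
    ∃ D D₂ : SpaceTime n → SpaceTime n → ℂ,
      (∀ e, HasWeakDerivOn (spaceTimeCylinder T Ω) e u (D e)) ∧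
      (∀ e, HasWeakDerivOn (spaceTimeCylinder T Ω) e (D e) (D₂ e)) ∧
      ∀ᵐ z ∂(volume.restrict (spaceTimeCylinder T Ω)),
        D₂ (timeDir n) z + 2 * (1 + a) * D (timeDir n) z + (1 + 2 * a) * u z
          - ∑ j, (D₂ (spaceDir j) z + 2 * a * ω j * D (spaceDir j) z) = f z := by
  choose D hD hD2 using F.exists_weakDeriv_two hu
  choose D₂ hD₂ using fun e => hD2 e e
  refine ⟨fun e => D e, fun e => D₂ e, fun e => F.hasWeakDerivOn e (hD e),
    fun e => F.hasWeakDerivOn e (hD₂ e), ?_⟩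
  have key := eq_of_repr_waveSymbol F.basis F.freq hf (hD (timeDir n)) (hD₂ (timeDir n))
    (fun j => hD (spaceDir j)) (fun j => hD₂ (spaceDir j))
  rw [← key]
  exact F.absolutelyContinuous.ae_le (coeFn_wave_combination _ _ _ _ _ _ _ _).symm

theorem integral_norm_sq_le (u : Lp ℂ 2 F.μ) :
    ∫ z in spaceTimeCylinder T Ω, ‖u z‖ ^ 2 ≤ F.scale.toReal⁻¹ * ‖u‖ ^ 2 := by
  have h1 : ∫ z, ‖u z‖ ^ 2 ∂F.μ = ‖u‖ ^ 2 := by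
    rw [← inner_self_eq_norm_sq (𝕜 := ℂ) u, F.inner_eq_integral]
    simp only [Complex.conj_mul']
    have h2 : ∫ z, ((‖u z‖ : ℂ)) ^ 2 ∂F.μ = ((∫ z, ‖u z‖ ^ 2 ∂F.μ : ℝ) : ℂ) := by
      rw [← integral_complex_ofReal]
      push_cast
      rfl
    rw [h2]
    exact (Complex.ofReal_re _).symm
  have hint : Integrable (fun z => ‖u z‖ ^ 2) F.μ := (Lp.memLp u).integrable_norm_pow two_ne_zero
  rw [← h1, ← smul_eq_mul, ← ENNReal.toReal_inv, ← integral_smul_measure]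
  refine integral_mono_measure F.restrict_cylinder_le
    (Eventually.of_forall fun z => by positivity) ?_
  exact hint.smul_measure (ENNReal.inv_ne_top.2 F.scale_ne_zero)

end FourierBox

/-- First and second weak derivatives of `exp l * (K + h exp l₀ u)`. -/
theorem hasWeakSecondDerivOn_exp_mul {U : Set (SpaceTime n)} (hU : IsOpen U) {e : SpaceTime n}
    {u D D₂ : SpaceTime n → ℂ} (h1 : HasWeakDerivOn U e u D) (h2 : HasWeakDerivOn U e D D₂)
    (l l₀ : SpaceTime n →L[ℝ] ℝ) (K h : ℂ) :
    HasWeakSecondDerivOn U e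
      (fun z => (Real.exp (l z) : ℂ) * (K + h * ((Real.exp (l₀ z) : ℂ) * u z)))
      (fun z => (Real.exp (l z) : ℂ) * (h * (Real.exp (l₀ z) : ℂ) *
        (D₂ z + 2 * (l₀ e + l e) * D z + (l₀ e + l e) ^ 2 * u z) + (l e : ℂ) ^ 2 * K)) := by
  have k0 := h1.exp_mul hU l₀
  have k1 := (hasWeakDerivOn_const U e K).add (k0.const_mul h)
  have k0' := (h2.add (h1.const_mul (l₀ e : ℂ))).exp_mul hU l₀
  have k1' := ((hasWeakDerivOn_const U e 0).add (k0'.const_mul h)).add (k1.const_mul (l e : ℂ))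
  refine ⟨_, k1.exp_mul hU l, ?_⟩
  convert! k1'.exp_mul hU l using 2 with z
  ring

/-- The phase divided by `h`, as a linear functional. -/
def scaledPhase (ω : EuclideanSpace ℝ (Fin n)) (a : ℝ) : SpaceTime n →L[ℝ] ℝ :=
  a • (ContinuousLinearMap.fst ℝ ℝ (EuclideanSpace ℝ (Fin n)) +
    (innerSL ℝ ω).comp (ContinuousLinearMap.snd ℝ ℝ (EuclideanSpace ℝ (Fin n))))

theorem scaledPhase_apply (ω : EuclideanSpace ℝ (Fin n)) (a : ℝ) (z : SpaceTime n) :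
    scaledPhase ω a z = a * phase ω z := by
  simp [scaledPhase, phase, real_inner_comm, mul_add]

theorem scaledPhase_timeDir (ω : EuclideanSpace ℝ (Fin n)) (a : ℝ) :
    scaledPhase ω a (timeDir n) = a := by
  simp [scaledPhase, timeDir]

theorem scaledPhase_spaceDir (ω : EuclideanSpace ℝ (Fin n)) (a : ℝ) (j : Fin n) :
    scaledPhase ω a (spaceDir j) = a * ω j := by
  simp [scaledPhase, spaceDir, EuclideanSpace.inner_single_right]

theorem memSobolev_sum {ι : Type*} {k : ℕ} {p : ℝ≥0∞} {U : Set (SpaceTime n)}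
    (hU : volume U ≠ ∞) (s : Finset ι) {u : ι → SpaceTime n → ℂ}
    (hu : ∀ i ∈ s, MemSobolev k p U (u i)) : MemSobolev k p U fun z => ∑ i ∈ s, u i z := by
  classical
  induction s using Finset.induction_on with
  | empty => simpa using memSobolev_const k p hU 0
  | insert a s ha ih =>
    simp only [Finset.sum_insert ha]
    exact (hu a (Finset.mem_insert_self a s)).add
      (ih fun i hi => hu i (Finset.mem_insert_of_mem hi))

/-- Conversion of the conjugated equation for `u` on the box into the wave equation for
`exp (φ / h) (K + h exp t u)`. -/
theorem hasWaveOn_of_conjugated (hΩ : IsOpen Ω) (F : FourierBox n T Ω) {a h : ℝ}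
    {ω : EuclideanSpace ℝ (Fin n)} (hω : ‖ω‖ = 1) {u f : Lp ℂ 2 F.μ}
    (hu : Summable fun k => (sobolevWeight (F.freq k) * ‖F.basis.repr u k‖) ^ 2)
    (hf : ∀ k, waveSymbol a ω (F.freq k) * F.basis.repr u k = F.basis.repr f k) (K : ℂ) :
    ∃ y, HasWaveOn (spaceTimeCylinder T Ω) (fun z => (Real.exp (scaledPhase ω a z) : ℂ) *
        (K + h * ((Real.exp (ContinuousLinearMap.fst ℝ ℝ _ z) : ℂ) * u z))) y ∧
      ∀ᵐ z ∂(volume.restrict (spaceTimeCylinder T Ω)),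
        y z = (Real.exp (scaledPhase ω a z) : ℂ) * (h * (Real.exp z.1 : ℂ) * f z) := by
  obtain ⟨D, D₂, hD, hD₂, heq⟩ := F.exists_wave_eq hu hf
  have key := fun e => hasWeakSecondDerivOn_exp_mul (isOpen_Ioo.prod hΩ) (hD e) (hD₂ e)
    (scaledPhase ω a) (ContinuousLinearMap.fst ℝ ℝ _) K h
  refine ⟨_, ⟨_, _, key (timeDir n), fun j => key (spaceDir j),
    Eventually.of_forall fun z => rfl⟩, ?_⟩
  -- The eikonal identity: the `a²` terms from time and space cancel.
  have hω2 : ∑ j, (ω j : ℂ) ^ 2 = 1 := by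
    have := EuclideanSpace.real_norm_sq_eq ω
    rw [hω, one_pow] at this
    exact_mod_cast this.symm
  filter_upwards [heq] with z hz
  have ht : (ContinuousLinearMap.fst ℝ ℝ (EuclideanSpace ℝ (Fin n))) (timeDir n) = 1 := rfl
  have hs : ∀ j, (ContinuousLinearMap.fst ℝ ℝ (EuclideanSpace ℝ (Fin n))) (spaceDir j) = 0 :=
    fun j => rfl
  have hz1 : (ContinuousLinearMap.fst ℝ ℝ (EuclideanSpace ℝ (Fin n))) z = z.1 := rfl
  simp only [scaledPhase_timeDir, scaledPhase_spaceDir, ht, hs, hz1]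
  rw [← hz, ← Finset.mul_sum, ← mul_sub]
  congr 1
  have e1 : ∀ j, (h : ℂ) * (Real.exp z.1 : ℂ) * (D₂ (spaceDir j) z
      + 2 * (((0 : ℝ) : ℂ) + ((a * ω j : ℝ) : ℂ)) * D (spaceDir j) z
      + (((0 : ℝ) : ℂ) + ((a * ω j : ℝ) : ℂ)) ^ 2 * u z) + ((a * ω j : ℝ) : ℂ) ^ 2 * K =
      (h : ℂ) * (Real.exp z.1 : ℂ) * (D₂ (spaceDir j) z + 2 * a * ω j * D (spaceDir j) z) +
      (ω j : ℂ) ^ 2 * (a ^ 2 * ((h : ℂ) * (Real.exp z.1 : ℂ) * u z + K)) := by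
    intro j; push_cast; ring
  simp only [e1]
  rw [Finset.sum_add_distrib, ← Finset.mul_sum, ← Finset.sum_mul, hω2]
  push_cast
  ring

end WaveCGO

/-! ### Assembly of the solution. -/

open WaveCGO Filter in
theorem proposition5p3 (n : ℕ) (hn : 2 ≤ n)
    (Ω : Set (EuclideanSpace ℝ (Fin n))) (hΩ_open : IsOpen Ω)
    (hΩ_bdd : Bornology.IsBounded Ω) (hΩ_C2 : HasC2Boundary Ω)
    (T : ℝ) (hT : 0 < T)
    (ω : EuclideanSpace ℝ (Fin n)) (hω : ‖ω‖ = 1)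
    (q : SpaceTime n → Matrix (Fin n) (Fin n) ℂ)
    (hq : MemMatrixW1Infty (spaceTimeCylinder T Ω) q) :
    ∃ h₀ : ℝ, 0 < h₀ ∧ ∀ K : Fin n → ℂ, ∃ C : ℝ, 0 < C ∧
      ∀ h : ℝ, 0 < h → h ≤ h₀ →
        ∃ v R : SpaceTime n → Fin n → ℂ,
          MemVecH2 (spaceTimeCylinder T Ω) v ∧
          SolvesWaveSystemOn (spaceTimeCylinder T Ω) q v ∧
          MemVecH2 (spaceTimeCylinder T Ω) R ∧
          (∀ z ∈ spaceTimeCylinder T Ω, ∀ i,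
            v z i = (Real.exp (phase ω z / h) : ℂ) * (K i + (h : ℂ) * R z i)) ∧
          vecL2Norm (spaceTimeCylinder T Ω) R ≤ C := by
  have hQo : IsOpen (spaceTimeCylinder T Ω) := isOpen_Ioo.prod hΩ_open
  have hQb : Bornology.IsBounded (spaceTimeCylinder T Ω) := (Metric.isBounded_Ioo 0 T).prod hΩ_bdd
  have hQfin : volume (spaceTimeCylinder T Ω) ≠ ∞ := hQb.measure_lt_top.ne
  obtain ⟨F⟩ := exists_fourierBox (n := n) hT hΩ_bdd
  choose g g' M hM0 hg hgq using
    fun i j => F.exists_isTimeLipschitz_extension hΩ_open hΩ_bdd (hq i j)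
  set M₁ := ∑ i, ∑ j, M i j with hM₁
  have hM₁0 : 0 ≤ M₁ := Finset.sum_nonneg fun i _ => Finset.sum_nonneg fun j _ => hM0 i j
  have hMle : ∀ i j, M i j ≤ M₁ := fun i j =>
    (Finset.single_le_sum (f := fun j => M i j) (fun j _ => hM0 i j) (Finset.mem_univ j)).trans
      (Finset.single_le_sum (f := fun i => ∑ j, M i j)
        (fun i _ => Finset.sum_nonneg fun j _ => hM0 i j) (Finset.mem_univ i))
  have hpos : 0 < 2 * (n * M₁) + 1 := by positivity
  -- The threshold depends only on the extended potential and not on `K`; the `+ 1` covers the case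
  -- `M₁ = 0`.
  refine ⟨(2 * (n * M₁) + 1)⁻¹, inv_pos.2 hpos, fun K => ?_⟩
  set l₀ : SpaceTime n →L[ℝ] ℝ := ContinuousLinearMap.fst ℝ ℝ (EuclideanSpace ℝ (Fin n)) with hl₀
  -- The source is `e^{-t} q K`: its weight cancels the factor `e^t` in `R = e^t S`.
  have hrS : ∀ i, MemSobolev 1 ∞ (spaceTimeCylinder T Ω)
      fun z => (Real.exp ((-l₀) z) : ℂ) * ∑ j, K j * q z i j := fun i =>
    (memSobolev_sum hQfin Finset.univ fun j _ => (hq i j).const_mul (K j)).exp_mul hQb hQo (-l₀)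
  choose r r' N hN0 hr hrq using
    fun i => F.exists_isTimeLipschitz_extension hΩ_open hΩ_bdd (hrS i)
  set N₁ := ∑ i, N i with hN₁
  have hN₁0 : 0 ≤ N₁ := Finset.sum_nonneg fun i _ => hN0 i
  have hNle : ∀ i, N i ≤ N₁ := fun i =>
    Finset.single_le_sum (fun i _ => hN0 i) (Finset.mem_univ i)
  -- Here `e^T` bounds `e^t` on the cylinder, `F.scale.toReal⁻¹` undoes the normalisation of the
  -- measure, `2 * N₁` bounds `S`, and the `+ 1` ensures positivity.
  refine ⟨Real.sqrt (∑ _j : Fin n, Real.exp T ^ 2 * (F.scale.toReal⁻¹ * (2 * N₁) ^ 2)) + 1,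
    by positivity, fun h h0 hh => ?_⟩
  have hah : h * h⁻¹ = 1 := mul_inv_cancel₀ h0.ne'
  set a := h⁻¹ with ha
  have ha0 : 0 < a := inv_pos.2 h0
  have haM : 2 * (n * M₁) ≤ a := by
    have h1 : 2 * (n * M₁) + 1 ≤ a := by
      rw [ha, le_inv_comm₀ hpos h0]
      exact hh
    linarith
  obtain ⟨S, f, hSn, hf, hsym, hSW⟩ := F.exists_system_solution hω hM₁0 hN₁0
    (fun i j => (hg i j).mono (hMle i j)) (fun i => (hr i).mono (hNle i)) ha0 haM
  have hR : ∀ i, MemSobolev 2 2 (spaceTimeCylinder T Ω) fun z => (Real.exp (l₀ z) : ℂ) * S i z :=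
    fun i => (F.memSobolev_two (hSW i)).exp_mul hQb hQo l₀
  refine ⟨fun z i => (Real.exp (scaledPhase ω a z) : ℂ) *
      (K i + h * ((Real.exp (l₀ z) : ℂ) * S i z)),
    fun z i => (Real.exp (l₀ z) : ℂ) * S i z, fun i => ?_, fun i => ?_, hR, fun z _ i => ?_, ?_⟩
  · exact ((memSobolev_const 2 2 hQfin (K i)).add ((hR i).const_mul h)).exp_mul hQb hQo _
  · obtain ⟨y, hy, hyf⟩ := hasWaveOn_of_conjugated hΩ_open F (h := h) hω (hSW i) (hsym i) (K i)
    refine ⟨y, hy, ?_⟩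
    have hgall : ∀ᵐ z ∂(volume.restrict (spaceTimeCylinder T Ω)), ∀ j, q z i j = g i j z :=
      ae_all_iff.2 fun j => hgq i j
    filter_upwards [hyf, F.absolutelyContinuous.ae_le (hf i), hgall, hrq i] with z h1 h2 h3 h4
    have h5 : (Real.exp (l₀ z) : ℂ) * (Real.exp ((-l₀) z) : ℂ) = 1 := by
      rw [neg_apply, ← Complex.ofReal_mul, ← Real.exp_add, add_neg_cancel, Real.exp_zero,
        Complex.ofReal_one]
    have h6 : (h : ℂ) * (a : ℂ) = 1 := by exact_mod_cast hah
    have h7 : ∑ j, q z i j * ((Real.exp (scaledPhase ω a z) : ℂ) *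
          (K j + h * ((Real.exp (l₀ z) : ℂ) * S j z))) =
        (Real.exp (scaledPhase ω a z) : ℂ) * (∑ j, K j * q z i j +
          h * (Real.exp (l₀ z) : ℂ) * ∑ j, g i j z * S j z) := by
      rw [Finset.mul_sum, ← Finset.sum_add_distrib, Finset.mul_sum]
      refine Finset.sum_congr rfl fun j _ => ?_
      rw [← h3]
      ring
    have h8 : (Real.exp z.1 : ℂ) = (Real.exp (l₀ z) : ℂ) := rfl
    rw [h7, h1, h2, ← h4, h8]
    -- The terms in `S` cancel at once; those in `K` cancel through `h a = 1` and `e^t e^{-t} = 1`.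
    linear_combination (-(Real.exp (scaledPhase ω a z) : ℂ) * ∑ j, K j * q z i j) *
      (h6 * ((Real.exp (l₀ z) : ℂ) * (Real.exp ((-l₀) z) : ℂ)) + h5)
  · simp only [scaledPhase_apply, ha, div_eq_inv_mul]
  · refine le_trans (Real.sqrt_le_sqrt (Finset.sum_le_sum fun j _ => ?_))
      (le_add_of_nonneg_right zero_le_one)
    have hint : Integrable (fun z => ‖S j z‖ ^ 2) (volume.restrict (spaceTimeCylinder T Ω)) :=
      (F.memLp_cylinder (Lp.memLp (S j))).integrable_norm_pow two_ne_zero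
    calc ∫ z in spaceTimeCylinder T Ω, ‖(Real.exp (l₀ z) : ℂ) * S j z‖ ^ 2
        ≤ ∫ z in spaceTimeCylinder T Ω, Real.exp T ^ 2 * ‖S j z‖ ^ 2 := by
          refine integral_mono_ae ((hR j).memLp.integrable_norm_pow two_ne_zero)
            (hint.const_mul _) ?_
          filter_upwards [ae_restrict_mem hQo.measurableSet] with z hz
          rw [norm_mul, mul_pow, Complex.norm_real, Real.norm_of_nonneg (Real.exp_pos _).le]
          have : l₀ z ≤ T := hz.1.2.le
          gcongr
      _ = Real.exp T ^ 2 * ∫ z in spaceTimeCylinder T Ω, ‖S j z‖ ^ 2 := integral_const_mul _ _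
      _ ≤ Real.exp T ^ 2 * (F.scale.toReal⁻¹ * (2 * N₁) ^ 2) := by
          gcongr
          refine (F.integral_norm_sq_le (S j)).trans ?_
          gcongr
          exact hSn j

end
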